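/- \textbf{Setting.} Let $P$ be a probability distribution on $\mathbb R$ with mean $\mu$ and variance $\sigma^2$, $0<\sigma^2<\infty$, and let $p\ge 1$ and $C\in[0,1)$, where $C$ is a numerical constant fixed in advance. A sample $X_1,\dots,X_{N'}$ of i.i.d. random variables with law $P$ is merged with $\mathcal O$ real random outliers of arbitrary joint law, and the resulting $N=N'+\mathcal O$ observations are listed in a uniformly random order; $(X_1,\dots,X_{N'})$ is independent of the outliers and the order jointly. For $k=2^i$, $1\le i\le\lfloor\log_2N\rfloor$, fix a (nonrandom) partition $\{1,\dots,N\}=G_1\cup\dots\cup G_k$ into blocks of size $N/k$ if $k$ divides $N$, and of sizes $\lfloor N/k\rfloor$ or $\lfloor N/k\rfloor+1$ in general. Let $\bar\mu_j$ and $\widehat\sigma_j=\big(|G_j|^{-1}\sum_{i\in G_j}(x_i-\bar\mu_j)^2\big)^{1/2}$ be the mean and the standard deviation of the observations $x_i$, $i\in G_j$, and put $$\widehat\mu_{N,p}(k)=\sum_{j=1}^k\frac{\widehat\sigma_j^{-p}}{\sum_{l=1}^k\widehat\sigma_l^{-p}}\,\bar\mu_j .$$ Let $\widetilde\sigma$ be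 a real random variable (the preliminary scale estimate, which may depend on all the data), and let $\widetilde{\mathcal E}_p(k)$ be the event that $$\Big(\frac1k\sum_{j=1}^k\frac1{\widehat\sigma_j^p}\Big)^{-1}\le\Big(\frac{80\,\widetilde\sigma}{1-C}\Big)^p ,$$ with $1/0=\infty$ and $1/\infty=0$, so that it holds if some $\widehat\sigma_j=0$. Let $\tilde k=2^{\tilde\imath}$, where $\tilde\imath$ is the smallest $i\in\{1,\dots,\lfloor\log_2N\rfloor\}$ for which $\widetilde{\mathcal E}_p(2^i)$ holds, and $\tilde\imath=1$ if there is none. Put $\widetilde\mu_p=\widehat\mu_{N,p}(\tilde k)$. \textbf{Theorem 4.} There are a constant $c>0$ depending only on $P$ and a constant $C_p>0$ depending only on $p$ (for the given numerical constant $C$) such that the following holds. If $2\le\mathcal O\le N/4$, if $\eta\in\mathbb R$ is such that $1/20\le\widetilde\sigma/\sigma\le4$ with probability at least $1-\eta$ (in particular $\eta=0$ if these bounds hold almost surely), and if $s>0$, then with probability at least $$1-2\log_2(3\mathcal O)\,e^{-s}-\mathcal O\,e^{-cN/\mathcal O}-e^{-c\mathcal O}-\eta$$ all the block standard deviations $\widehat\sigma_1,\dots,\widehat\sigma_{\tilde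 k}$ are positive (so that the weights are well defined) and $$|\widetilde\mu_p-\mu|\le C_p\,\sigma\left(\sqrt{\frac sN}+\sqrt{\frac{\mathcal O}N}\right).$$ -/

import Mathlib

open MeasureTheory ProbabilityTheory

namespace RobustMean

/-- The set of permutations of a finite set carries the discrete sigma-algebra. -/
instance permMeasurableSpace (n : ℕ) : MeasurableSpace (Equiv.Perm (Fin n)) := ⊤

/-- The mean of a probability measure on the line. -/
noncomputable def mean (P : Measure ℝ) : ℝ := ∫ x, x ∂P

/-- The standard deviation of a probability measure on the line. -/
noncomputable def stdDev (P : Measure ℝ) : ℝ := √(Var[id; P])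

/-- The family `G` partitions the index set `Fin N` into `k` blocks of equal size, up to rounding:
every block has size `⌊N / k⌋` or `⌊N / k⌋ + 1`. If `k` divides `N`, all blocks have size `N / k`. -/
structure IsBlockPartition {N k : ℕ} (G : Fin k → Finset (Fin N)) : Prop where
  disjoint : ∀ i j, i ≠ j → Disjoint (G i) (G j)
  cover : ∀ a, ∃ j, a ∈ G j
  le_card : ∀ j, N / k ≤ (G j).card
  card_le : ∀ j, (G j).card ≤ N / k + 1

/-- The sample mean over one block of the data `x`. -/
noncomputable def blockMean {N : ℕ} (x : Fin N → ℝ) (B : Finset (Fin N)) : ℝ :=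
  (∑ i ∈ B, x i) / (B.card : ℝ)

/-- The sample standard deviation over one block of the data `x`. -/
noncomputable def blockStd {N : ℕ} (x : Fin N → ℝ) (B : Finset (Fin N)) : ℝ :=
  √((∑ i ∈ B, (x i - blockMean x B) ^ 2) / (B.card : ℝ))

/-- The weight of block `j`: the inverse `p`-th power of its sample standard deviation, normalized
so that the weights sum up to one. Meaningful when all the sample standard deviations are
positive. -/
noncomputable def blockWeight {N k : ℕ} (p : ℝ) (x : Fin N → ℝ) (G : Fin k → Finset (Fin N))
    (j : Fin k) : ℝ :=
  (1 / blockStd x (G j) ^ p) / ∑ l, 1 / blockStd x (G l) ^ p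

/-- The weighted average of the block means. -/
noncomputable def blockEstimator {N k : ℕ} (p : ℝ) (x : Fin N → ℝ)
    (G : Fin k → Finset (Fin N)) : ℝ :=
  ∑ j, blockWeight p x G j * blockMean x (G j)

/-- The harmonic mean of the `p`-th powers of the sample standard deviations is at most
`(80 τ / (1 - C)) ^ p`, where `τ` is the preliminary scale estimate. As `1 / 0 = ∞` and
`1 / ∞ = 0` here, this is true when one of the sample standard deviations vanishes. -/
def ScaleTest {N k : ℕ} (C p τ : ℝ) (x : Fin N → ℝ) (G : Fin k → Finset (Fin N)) : Prop :=
  (∃ j, blockStd x (G j) = 0) ∨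
    ((1 / (k : ℝ)) * ∑ j, 1 / blockStd x (G j) ^ p)⁻¹ ≤ (80 * τ / (1 - C)) ^ p

/-- The smallest `i ∈ {1, …, ⌊log₂ N⌋}` such that the test holds for `2 ^ i` blocks, and `1` if
there is none (`sInf ∅ = 0` for natural numbers). -/
noncomputable def selectedExponent {N : ℕ} (C p τ : ℝ) (x : Fin N → ℝ)
    (G : (k : ℕ) → Fin k → Finset (Fin N)) : ℕ :=
  max (sInf {i : ℕ | 1 ≤ i ∧ i ≤ Nat.log 2 N ∧ ScaleTest C p τ x (G (2 ^ i))}) 1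

/-- The data-driven number of blocks. -/
noncomputable def selectedBlocks {N : ℕ} (C p τ : ℝ) (x : Fin N → ℝ)
    (G : (k : ℕ) → Fin k → Finset (Fin N)) : ℕ :=
  2 ^ selectedExponent C p τ x G

/-- The adaptive estimator: the weighted average with the data-driven number of blocks. -/
noncomputable def adaptiveEstimator {N : ℕ} (C p τ : ℝ) (x : Fin N → ℝ)
    (G : (k : ℕ) → Fin k → Finset (Fin N)) : ℝ :=
  blockEstimator p x (G (selectedBlocks C p τ x G))

/-- The merged sample: the inliers `x` and the outliers `y`, listed in the order given by the
permutation `π`. -/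
def mergedSample {m o : ℕ} (x : Fin m → ℝ) (y : Fin o → ℝ) (π : Equiv.Perm (Fin (m + o))) :
    Fin (m + o) → ℝ :=
  fun i => Fin.append x y (π i)

/-- The contamination model: `X 0, …, X (m - 1)` are independent with law `P`, the outliers
`Y 0, …, Y (o - 1)` have an arbitrary joint law, the order `π` in which the merged sample is listed
is uniformly random, and the inliers are independent of the outliers and of the order. -/
structure IsContaminatedSample {Ω : Type*} [MeasurableSpace Ω] (Pr : Measure Ω) (P : Measure ℝ)
    {m o : ℕ} (X : Fin m → Ω → ℝ) (Y : Fin o → Ω → ℝ)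
    (π : Ω → Equiv.Perm (Fin (m + o))) : Prop where
  measurable_inlier : ∀ i, Measurable (X i)
  measurable_outlier : ∀ i, Measurable (Y i)
  measurable_order : Measurable π
  law_inlier : ∀ i, Pr.map (X i) = P
  indep_inlier : iIndepFun X Pr
  law_order : Pr.map π = uniformOn Set.univ
  indep : IndepFun (fun ω i => X i ω) (fun ω => ((fun i => Y i ω), π ω)) Pr

end RobustMean

/-!
The estimator is a weighted mean of block means, and the weights `σ̂_j ^ (-p)` turn it into an
average of self-normalized block means `(μ̄_j - μ) / σ̂_j`, which are robust in two ways.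

* Outliers: by the Cauchy-Schwarz inequality, `r` outliers among the `n` data of a block move its
  mean by at most a multiple of `σ̂_j √(r / n)`, whatever their values (`abs_blockMean_sub_le`).
  As `p ≥ 1`, the weights satisfy `w_j σ̂_j ≲ σ / k` once all `σ̂_j ≳ σ` and the scale test is
  passed (`weight_mul_le`), so that the outliers contribute `O(σ √(o / N))` for any number `k` of
  blocks.
* Heavy tails: the inequality `exp (u - u² / 6) ≤ 1 + u + u² / 3` makes self-normalized sums
  sub-Gaussian under a second moment only (`lintegral_exp_selfNormSq_le`). Hence the squares of
  those of the `k` disjoint blocks add up to `O(k + s)` with probability at least `1 - exp (-s)`,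
  and the inliers contribute `O(σ √((k + s) / N))`.

It remains to see that `k = O(o)` and that `σ̂_j ≳ σ` in all blocks. If `k` is about `8 o`, at
most an eighth of the blocks contains outliers, and Chernoff's bound shows that half of the blocks
have `σ̂_j ≤ 2 σ`, except with probability `exp (-o / 4)`; then the test is passed
(`harmonic_mean_le`), so the selected `k` is at most `16 o`. A block has at least a quarter of
inliers with high probability, since the order is uniformly random (`card_perm_many_marked_le`),
and the second moment of these inliers is not small, except with a probability exponentially small
in the block size, at a rate that depends on the law of the inliers
(`exists_measureReal_devSq_le`). The blocks of all levels number `O(o)`, and their sizes are at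
least of the order `N / o`.

The inliers are independent of the order and of the outliers. As the bounds hold for all values of
the outliers, probabilities are needed for fixed orders and for the inliers only
(`measureReal_le_of_indepFun`).
-/

namespace RobustMean

/-! ### Block statistics of independent data -/

/-- The sum of the deviations from `a` over the index set `J`. -/
noncomputable def devSum {ι : Type*} (a : ℝ) (J : Finset ι) (x : ι → ℝ) : ℝ := ∑ i ∈ J, (x i - a)

/-- The sum of the squared deviations from `a` over the index set `J`. -/
noncomputable def devSq {ι : Type*} (a : ℝ) (J : Finset ι) (x : ι → ℝ) : ℝ :=
  ∑ i ∈ J, (x i - a) ^ 2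

/-- The square of the self-normalized sum of the deviations from `a`: the normalization mixes the
empirical second moment and the variance `v`. The weights `1 / 3` and `5 / 3` are those for which
the exponential moment below comes out; the value for empty `J` is `0`. -/
noncomputable def selfNormSq {ι : Type*} (a v : ℝ) (J : Finset ι) (x : ι → ℝ) : ℝ :=
  devSum a J x ^ 2 / (devSq a J x / 3 + 5 / 3 * (J.card * v))

theorem devSq_nonneg {ι : Type*} (a : ℝ) (J : Finset ι) (x : ι → ℝ) : 0 ≤ devSq a J x :=
  Finset.sum_nonneg fun _ _ => sq_nonneg _

theorem selfNormSq_nonneg {ι : Type*} (a : ℝ) {v : ℝ} (hv : 0 ≤ v) (J : Finset ι) (x : ι → ℝ) :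
    0 ≤ selfNormSq a v J x := by
  have := devSq_nonneg a J x
  unfold selfNormSq; positivity

@[fun_prop]
theorem measurable_devSum {ι : Type*} (a : ℝ) (J : Finset ι) : Measurable (devSum a J) := by
  unfold devSum; fun_prop

@[fun_prop]
theorem measurable_devSq {ι : Type*} (a : ℝ) (J : Finset ι) : Measurable (devSq a J) := by
  unfold devSq; fun_prop

@[fun_prop]
theorem measurable_selfNormSq {ι : Type*} (a v : ℝ) (J : Finset ι) :
    Measurable (selfNormSq a v J) := by
  unfold selfNormSq; fun_prop

theorem dependsOn_devSum {ι : Type*} (a : ℝ) (J : Finset ι) : DependsOn (devSum a J) J :=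
  fun _ _ h => Finset.sum_congr rfl fun i hi => by rw [h i (Finset.mem_coe.2 hi)]

theorem dependsOn_devSq {ι : Type*} (a : ℝ) (J : Finset ι) : DependsOn (devSq a J) J :=
  fun _ _ h => Finset.sum_congr rfl fun i hi => by rw [h i (Finset.mem_coe.2 hi)]

theorem dependsOn_selfNormSq {ι : Type*} (a v : ℝ) (J : Finset ι) :
    DependsOn (selfNormSq a v J) J := fun x y h => by
  unfold selfNormSq; rw [dependsOn_devSum a J h, dependsOn_devSq a J h]

/-- Functions of disjoint groups of coordinates are independent under a product measure. -/
theorem lintegral_prod_of_dependsOn {ι κ : Type*} [Fintype ι] (P : Measure ℝ)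
    [IsProbabilityMeasure P] (J : κ → Finset ι) (hJ : ∀ i j, i ≠ j → Disjoint (J i) (J j))
    (F : κ → (ι → ℝ) → ENNReal) (hF : ∀ j, Measurable (F j)) (hdep : ∀ j, DependsOn (F j) (J j))
    (s : Finset κ) :
    ∫⁻ x, ∏ j ∈ s, F j x ∂(Measure.pi fun _ : ι => P)
      = ∏ j ∈ s, ∫⁻ x, F j x ∂(Measure.pi fun _ : ι => P) := by
  classical
  have hind : iIndepFun (fun (i : ι) (x : ι → ℝ) => x i) (Measure.pi fun _ : ι => P) :=
    iIndepFun_pi (X := fun (_ : ι) (y : ℝ) => y) fun _ => aemeasurable_id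
  -- A function that depends on `T` only is a function of the restriction to `T`.
  let ext (T : Finset ι) (y : T → ℝ) : ι → ℝ := fun i => if h : i ∈ T then y ⟨i, h⟩ else 0
  have hext (T : Finset ι) : Measurable (ext T) := by
    refine measurable_pi_lambda _ fun i => ?_
    by_cases h : i ∈ T
    · simpa [ext, h] using measurable_pi_apply _
    · simp [ext, h]
  induction s using Finset.induction_on with
  | empty => simp
  | insert j s hj ih =>
    simp_rw [Finset.prod_insert hj]
    rw [← ih]
    have hdis : Disjoint (J j) (s.biUnion J) := by
      rw [Finset.disjoint_biUnion_right]
      exact fun i hi => hJ _ _ fun h => hj (h ▸ hi)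
    have hG : Measurable fun x => ∏ i ∈ s, F i x := by fun_prop
    have h := (hind.indepFun_finset (J j) (s.biUnion J) hdis fun i => measurable_pi_apply i).comp
      ((hF j).comp (hext _)) (hG.comp (hext _))
    rw [← lintegral_mul_eq_lintegral_mul_lintegral_of_indepFun (hF j) hG]
    · rfl
    · convert h using 1
      · funext x
        refine hdep j fun i hi => ?_
        simp [ext, Finset.mem_coe.1 hi]
      · funext x
        refine Finset.prod_congr rfl fun k hk => hdep k fun i hi => ?_
        have : i ∈ s.biUnion J := Finset.mem_biUnion.2 ⟨k, hk, hi⟩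
        simp only [ext, this, dif_pos]

theorem lintegral_pi_eval {ι : Type*} [Fintype ι] (P : Measure ℝ) [IsProbabilityMeasure P]
    (i : ι) {f : ℝ → ENNReal} (hf : Measurable f) :
    ∫⁻ x, f (x i) ∂(Measure.pi fun _ : ι => P) = ∫⁻ y, f y ∂P :=
  (measurePreserving_eval (fun _ : ι => P) i).lintegral_comp hf

theorem lintegral_prod_eval {ι : Type*} [Fintype ι] (P : Measure ℝ) [IsProbabilityMeasure P]
    (J : Finset ι) {f : ℝ → ENNReal} (hf : Measurable f) :
    ∫⁻ x, ∏ i ∈ J, f (x i) ∂(Measure.pi fun _ : ι => P) = (∫⁻ y, f y ∂P) ^ J.card := by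
  have hind : iIndepFun (fun (i : ι) (x : ι → ℝ) => f (x i)) (Measure.pi fun _ : ι => P) :=
    iIndepFun_pi (X := fun (_ : ι) (y : ℝ) => f y) fun _ => hf.aemeasurable
  rw [lintegral_prod_eq_prod_lintegral_of_indepFun J _ hind fun i => by fun_prop,
    Finset.prod_congr rfl fun i _ => lintegral_pi_eval P i hf, Finset.prod_const]

/-- The exponential inequality behind the sub-Gaussian behaviour of self-normalized sums. The
logarithm of the right-hand side minus the exponent has the derivative
`(u ^ 3 / 9) / (1 + u + u ^ 2 / 3)`, hence its minimum at `0`. -/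
theorem exp_sub_sq_le (u : ℝ) : Real.exp (u - u ^ 2 / 6) ≤ 1 + u + u ^ 2 / 3 := by
  have hpos : ∀ t : ℝ, 0 < 1 + t + t ^ 2 / 3 := fun t => by nlinarith [sq_nonneg (t + 3 / 2)]
  let f : ℝ → ℝ := fun t => Real.log (1 + t + t ^ 2 / 3) - t + t ^ 2 / 6
  have hd : ∀ t, HasDerivAt f ((t ^ 3 / 9) / (1 + t + t ^ 2 / 3)) t := fun t => by
    have h1 : HasDerivAt (fun t : ℝ => 1 + t + t ^ 2 / 3) (1 + 2 * t / 3) t := by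
      have := ((hasDerivAt_id t).const_add 1).add (((hasDerivAt_id t).pow 2).div_const 3)
      refine this.congr_deriv ?_
      simp
    have h2 := ((h1.log (hpos t).ne').sub (hasDerivAt_id t)).add
      (((hasDerivAt_id t).pow 2).div_const 6)
    refine h2.congr_deriv ?_
    obtain ⟨D, hD⟩ : ∃ D, D = 1 + t + t ^ 2 / 3 := ⟨_, rfl⟩
    have hD0 : D ≠ 0 := hD ▸ (hpos t).ne'
    rw [← hD]
    simp only [id]
    field_simp
    rw [hD]
    push_cast
    ring
  have hf0 : f 0 = 0 := by simp [f]
  have hfu : 0 ≤ f u := by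
    have hdiff : Differentiable ℝ f := fun t => (hd t).differentiableAt
    rcases le_total 0 u with h | h
    · rw [← hf0]
      refine monotoneOn_of_deriv_nonneg (convex_Ici 0) hdiff.continuous.continuousOn
        hdiff.differentiableOn (fun t ht => ?_) (Set.mem_Ici.2 le_rfl) h h
      rw [interior_Ici, Set.mem_Ioi] at ht
      rw [(hd t).deriv]
      have := hpos t
      positivity
    · rw [← hf0]
      refine antitoneOn_of_deriv_nonpos (convex_Iic 0) hdiff.continuous.continuousOn
        hdiff.differentiableOn (fun t ht => ?_) h (Set.mem_Iic.2 le_rfl) h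
      rw [interior_Iic, Set.mem_Iio] at ht
      rw [(hd t).deriv]
      refine div_nonpos_of_nonpos_of_nonneg ?_ (hpos t).le
      have := Odd.pow_neg (n := 3) (by decide) ht
      linarith
  rw [← Real.le_log_iff_exp_le (hpos u)]
  simp only [f] at hfu
  linarith

/-! ### Exponential moments of self-normalized sums -/

section Moments

variable {P : Measure ℝ}

theorem integral_sub_mean_sq (hP : MemLp id 2 P) :
    ∫ y, (y - mean P) ^ 2 ∂P = stdDev P ^ 2 := by
  rw [stdDev, Real.sq_sqrt (variance_nonneg _ _),
    variance_eq_integral hP.aestronglyMeasurable.aemeasurable]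
  rfl

variable [IsProbabilityMeasure P]

theorem integrable_sub_mean (hP : MemLp id 2 P) : Integrable (fun y => y - mean P) P :=
  (hP.integrable (by norm_num)).sub (integrable_const _)

theorem integrable_sub_mean_sq (hP : MemLp id 2 P) : Integrable (fun y => (y - mean P) ^ 2) P :=
  (hP.sub (memLp_const (mean P))).integrable_sq

theorem integral_sub_mean (hP : MemLp id 2 P) : ∫ y, (y - mean P) ∂P = 0 := by
  have h : Integrable (fun y : ℝ => y) P := hP.integrable (by norm_num)
  rw [integral_sub h (integrable_const _)]
  simp [mean]

theorem lintegral_sub_mean_sq (hP : MemLp id 2 P) :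
    ∫⁻ y, ENNReal.ofReal ((y - mean P) ^ 2) ∂P = ENNReal.ofReal (stdDev P ^ 2) := by
  rw [← integral_sub_mean_sq hP, ofReal_integral_eq_lintegral_ofReal (integrable_sub_mean_sq hP)
    (ae_of_all _ fun _ => sq_nonneg _)]

theorem lintegral_exp_le (hP : MemLp id 2 P) (t : ℝ) :
    ∫⁻ y, ENNReal.ofReal (Real.exp (t * (y - mean P) - (t * (y - mean P)) ^ 2 / 6)) ∂P
      ≤ ENNReal.ofReal (Real.exp (t ^ 2 * stdDev P ^ 2 / 3)) := by
  have h1 := (integrable_sub_mean hP).const_mul t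
  have h2 := (integrable_sub_mean_sq hP).const_mul (t ^ 2 / 3)
  have h3 : Integrable (fun y => 1 + t * (y - mean P)) P := (integrable_const 1).add h1
  calc _ ≤ ∫⁻ y, ENNReal.ofReal (1 + t * (y - mean P) + t ^ 2 / 3 * (y - mean P) ^ 2) ∂P := by
        refine lintegral_mono fun y => ENNReal.ofReal_le_ofReal ?_
        refine (exp_sub_sq_le _).trans (le_of_eq ?_)
        ring
    _ = ENNReal.ofReal (∫ y, (1 + t * (y - mean P) + t ^ 2 / 3 * (y - mean P) ^ 2) ∂P) := by
        refine (ofReal_integral_eq_lintegral_ofReal (h3.add h2) ?_).symm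
        refine ae_of_all _ fun y => ?_
        simp only [Pi.zero_apply, Pi.add_apply]
        nlinarith [sq_nonneg (t * (y - mean P) + 3 / 2)]
    _ = ENNReal.ofReal (t ^ 2 * stdDev P ^ 2 / 3 + 1) := by
        rw [integral_add h3 h2, integral_add (integrable_const 1) h1,
          integral_const_mul, integral_const_mul, integral_sub_mean hP, integral_sub_mean_sq hP]
        simp
        ring_nf
    _ ≤ _ := ENNReal.ofReal_le_ofReal (Real.add_one_le_exp _)

variable {ι : Type*} [Fintype ι]

theorem lintegral_exp_devSum_le (hP : MemLp id 2 P) (J : Finset ι) (t : ℝ) :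
    ∫⁻ x, ENNReal.ofReal
        (Real.exp (t * devSum (mean P) J x - t ^ 2 * devSq (mean P) J x / 6))
        ∂(Measure.pi fun _ : ι => P)
      ≤ ENNReal.ofReal (Real.exp (t ^ 2 * (J.card * stdDev P ^ 2) / 3)) := by
  have hm : Measurable fun y : ℝ =>
      ENNReal.ofReal (Real.exp (t * (y - mean P) - (t * (y - mean P)) ^ 2 / 6)) := by fun_prop
  have h := lintegral_prod_eval P J hm
  have e : ∀ x : ι → ℝ, ∏ i ∈ J,
      ENNReal.ofReal (Real.exp (t * (x i - mean P) - (t * (x i - mean P)) ^ 2 / 6)) =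
      ENNReal.ofReal (Real.exp (t * devSum (mean P) J x - t ^ 2 * devSq (mean P) J x / 6)) := by
    intro x
    rw [← ENNReal.ofReal_prod_of_nonneg fun _ _ => (Real.exp_pos _).le, ← Real.exp_sum, devSum,
      devSq, Finset.mul_sum, Finset.mul_sum, Finset.sum_div, ← Finset.sum_sub_distrib]
    simp_rw [mul_pow]
  simp_rw [e] at h
  rw [h]
  refine (pow_le_pow_left₀ (zero_le) (lintegral_exp_le hP t) _).trans (le_of_eq ?_)
  rw [← ENNReal.ofReal_pow (Real.exp_pos _).le, ← Real.exp_nat_mul]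
  congr 2
  ring

theorem lintegral_devSq (hP : MemLp id 2 P) (J : Finset ι) :
    ∫⁻ x, ENNReal.ofReal (devSq (mean P) J x) ∂(Measure.pi fun _ : ι => P)
      = ENNReal.ofReal (J.card * stdDev P ^ 2) := by
  simp_rw [devSq, ENNReal.ofReal_sum_of_nonneg fun _ _ => sq_nonneg _]
  rw [lintegral_finsetSum _ fun i _ => by fun_prop]
  have hm : Measurable fun y : ℝ => ENNReal.ofReal ((y - mean P) ^ 2) := by fun_prop
  rw [Finset.sum_congr rfl fun i _ => lintegral_pi_eval P i hm, lintegral_sub_mean_sq hP]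
  simp [ENNReal.ofReal_mul]

/-- The Gaussian integral of `exp (t S - t² D / 2)`, by completing the square. -/
theorem lintegral_exp_quadratic (S : ℝ) {D : ℝ} (hD : 0 < D) :
    ∫⁻ t : ℝ, ENNReal.ofReal (Real.exp (t * S - t ^ 2 * D / 2))
      = ENNReal.ofReal (√(2 * Real.pi / D) * Real.exp (S ^ 2 / (2 * D))) := by
  have e : ∀ t : ℝ, Real.exp (t * S - t ^ 2 * D / 2) =
      Real.exp (S ^ 2 / (2 * D)) * Real.exp (-(D / 2) * (t - S / D) ^ 2) := fun t => by
    rw [← Real.exp_add]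
    congr 1
    field_simp
    ring
  have hi : Integrable fun t : ℝ => Real.exp (-(D / 2) * (t - S / D) ^ 2) :=
    (integrable_exp_neg_mul_sq (half_pos hD)).comp_sub_right (S / D)
  simp_rw [e]
  rw [← ofReal_integral_eq_lintegral_ofReal (hi.const_mul _)
    (ae_of_all _ fun t => by positivity), integral_const_mul,
    integral_sub_right_eq_self (fun t : ℝ => Real.exp (-(D / 2) * t ^ 2)), integral_gaussian,
    mul_comm]
  have : Real.pi / (D / 2) = 2 * Real.pi / D := by field_simp
  rw [this]

/-- Self-normalized sums are sub-Gaussian under a second moment only. Averaging the exponential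
inequality for `devSum` over a Gaussian parameter `t` gives
`E [(1 + B / w) ^ (-1/2) exp (T / 2)] ≤ 1`, with `B = V / 3 + 2 w / 3` and `w` the variance of the
sum; the factor `(1 + B / w) ^ (-1/2)` is removed by the arithmetic-geometric mean inequality. -/
theorem lintegral_exp_selfNormSq_le (hP : MemLp id 2 P) (hσ : 0 < stdDev P) {J : Finset ι}
    (hJ : J.Nonempty) :
    ∫⁻ x, ENNReal.ofReal (Real.exp (selfNormSq (mean P) (stdDev P ^ 2) J x / 4))
        ∂(Measure.pi fun _ : ι => P) ≤ ENNReal.ofReal (5 / 4) := by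
  set Q := Measure.pi fun _ : ι => P
  set w : ℝ := J.card * stdDev P ^ 2 with hw_def
  have hw : 0 < w := mul_pos (Nat.cast_pos.2 hJ.card_pos) (pow_pos hσ 2)
  let S := devSum (mean P) J
  let V := devSq (mean P) J
  let D : (ι → ℝ) → ℝ := fun x => V x / 3 + 5 / 3 * w
  have hS : Measurable S := measurable_devSum _ _
  have hV : Measurable V := measurable_devSq _ _
  have hV0 : ∀ x, 0 ≤ V x := devSq_nonneg _ _
  have hD : ∀ x, 0 < D x := fun x => by have := hV0 x; positivity
  -- The averaged exponential inequality.
  have key : ∫⁻ x, ENNReal.ofReal (√(w / D x) * Real.exp (S x ^ 2 / (2 * D x))) ∂Q ≤ 1 := by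
    have h1 : ∫⁻ x, (∫⁻ t : ℝ, ENNReal.ofReal (Real.exp (t * S x - t ^ 2 * D x / 2))) ∂Q
        ≤ ENNReal.ofReal √(2 * Real.pi / w) := by
      rw [lintegral_lintegral_swap (by fun_prop)]
      calc _ ≤ ∫⁻ t : ℝ, ENNReal.ofReal (Real.exp (t * 0 - t ^ 2 * w / 2)) := by
            refine lintegral_mono fun t => ?_
            calc _ = ∫⁻ x, ENNReal.ofReal (Real.exp (-(t ^ 2 * (5 * w / 6)))) *
                  ENNReal.ofReal (Real.exp (t * S x - t ^ 2 * V x / 6)) ∂Q := by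
                  refine lintegral_congr fun x => ?_
                  rw [← ENNReal.ofReal_mul (Real.exp_pos _).le, ← Real.exp_add]
                  congr 2
                  simp only [D]
                  ring
              _ ≤ ENNReal.ofReal (Real.exp (-(t ^ 2 * (5 * w / 6)))) *
                  ENNReal.ofReal (Real.exp (t ^ 2 * w / 3)) := by
                  rw [lintegral_const_mul _ (by fun_prop)]
                  gcongr
                  exact lintegral_exp_devSum_le hP J t
              _ = _ := by
                  rw [← ENNReal.ofReal_mul (Real.exp_pos _).le, ← Real.exp_add]
                  congr 2
                  ring
        _ = _ := by rw [lintegral_exp_quadratic 0 hw]; simp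
    simp_rw [fun x => lintegral_exp_quadratic (S x) (hD x)] at h1
    have h2 : 0 < √(2 * Real.pi / w) := Real.sqrt_pos.2 (by positivity)
    have h3 : ∀ x, ENNReal.ofReal (√(2 * Real.pi / D x) * Real.exp (S x ^ 2 / (2 * D x))) =
        ENNReal.ofReal √(2 * Real.pi / w) *
          ENNReal.ofReal (√(w / D x) * Real.exp (S x ^ 2 / (2 * D x))) := fun x => by
      rw [← ENNReal.ofReal_mul h2.le, ← mul_assoc, ← Real.sqrt_mul (by positivity)]
      congr 4
      field_simp
    simp_rw [h3] at h1
    rw [lintegral_const_mul _ (by fun_prop)] at h1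
    nth_rewrite 2 [← mul_one (ENNReal.ofReal √(2 * Real.pi / w))] at h1
    exact (ENNReal.mul_le_mul_iff_right (by simpa using h2) ENNReal.ofReal_ne_top).1 h1
  have hpt : ∀ x, Real.exp (selfNormSq (mean P) (stdDev P ^ 2) J x / 4) ≤
      (√(w / D x) * Real.exp (S x ^ 2 / (2 * D x))) / 2 + (2 / 3 + V x / (12 * w)) := fun x => by
    have hr : 0 < w / D x := div_pos hw (hD x)
    have h4 : √(w / D x) * √(D x / w) = 1 := by
      rw [← Real.sqrt_mul hr.le, div_mul_div_cancel₀ (hD x).ne', div_self hw.ne', Real.sqrt_one]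
    have h5 : Real.exp (S x ^ 2 / (2 * D x)) =
        Real.exp (selfNormSq (mean P) (stdDev P ^ 2) J x / 4) ^ 2 := by
      rw [← Real.exp_nat_mul]
      congr 1
      simp only [selfNormSq, S, D, V, ← hw_def]
      push_cast
      have := (hD x).ne'
      simp only [D, V] at this
      field_simp
      ring
    have h6 : √(D x / w) ≤ (1 + D x / w) / 2 := by
      have := Real.sq_sqrt (div_pos (hD x) hw).le
      nlinarith [sq_nonneg (√(D x / w) - 1)]
    have h7 : (1 + D x / w) / 2 = 4 / 3 + V x / (6 * w) := by
      simp only [D]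
      field_simp
      ring
    rw [h5]
    have h8 : V x / (12 * w) = V x / (6 * w) / 2 := by field_simp; ring
    rw [h8]
    -- `e = √((A e²) B) ≤ (A e² + B) / 2` for `A B = 1`.
    set e := Real.exp (selfNormSq (mean P) (stdDev P ^ 2) J x / 4)
    have hA := Real.sqrt_nonneg (w / D x)
    have h9 : 2 * e ≤ √(w / D x) * e ^ 2 + √(D x / w) := by
      have := mul_nonneg hA (sq_nonneg (e - √(D x / w)))
      have h10 : √(w / D x) * (e - √(D x / w)) ^ 2 = √(w / D x) * e ^ 2 - 2 * e + √(D x / w) := by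
        linear_combination (√(D x / w) - 2 * e) * h4
      linarith
    linarith
  calc _ ≤ ∫⁻ x, (ENNReal.ofReal (1 / 2) *
          ENNReal.ofReal (√(w / D x) * Real.exp (S x ^ 2 / (2 * D x))) +
          (ENNReal.ofReal (2 / 3) + ENNReal.ofReal (1 / (12 * w)) * ENNReal.ofReal (V x))) ∂Q := by
        refine lintegral_mono fun x => (ENNReal.ofReal_le_ofReal (hpt x)).trans (le_of_eq ?_)
        have := hV0 x
        rw [← ENNReal.ofReal_mul (by norm_num), ← ENNReal.ofReal_mul (by positivity),
          ← ENNReal.ofReal_add (by norm_num) (by positivity),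
          ← ENNReal.ofReal_add (by positivity) (by positivity)]
        congr 1
        ring
    _ ≤ ENNReal.ofReal (1 / 2) * 1 + (ENNReal.ofReal (2 / 3) +
          ENNReal.ofReal (1 / (12 * w)) * ENNReal.ofReal w) := by
        rw [lintegral_add_left (by fun_prop), lintegral_const_mul _ (by fun_prop),
          lintegral_add_left (by fun_prop), lintegral_const_mul _ (by fun_prop),
          lintegral_devSq hP J]
        refine add_le_add (mul_le_mul' le_rfl key) (le_of_eq ?_)
        rw [lintegral_const, measure_univ, mul_one]
    _ = _ := by
        rw [mul_one, ← ENNReal.ofReal_mul (by positivity),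
          ← ENNReal.ofReal_add (by norm_num) (by positivity),
          ← ENNReal.ofReal_add (by norm_num) (by positivity)]
        congr 1
        field_simp
        norm_num

end Moments

/-! ### Tail bounds for the block statistics -/

theorem measureReal_le_of_lintegral_exp_le {α : Type*} [MeasurableSpace α] (Q : Measure α)
    {f : α → ℝ} (hf : Measurable f) {M : ℝ} (hM : 0 ≤ M)
    (h : ∫⁻ x, ENNReal.ofReal (Real.exp (f x)) ∂Q ≤ ENNReal.ofReal M) (b : ℝ) :
    Q.real {x | b ≤ f x} ≤ Real.exp (-b) * M := by
  have h1 := mul_meas_ge_le_lintegral (μ := Q)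
    (f := fun x => ENNReal.ofReal (Real.exp (f x))) (by fun_prop) (ENNReal.ofReal (Real.exp b))
  have h2 : {x | ENNReal.ofReal (Real.exp b) ≤ ENNReal.ofReal (Real.exp (f x))} =
      {x | b ≤ f x} := by
    ext x
    rw [Set.mem_ofPred_eq, ENNReal.ofReal_le_ofReal_iff (Real.exp_pos _).le, Real.exp_le_exp]
    rfl
  rw [h2] at h1
  have h3 := ENNReal.toReal_mono ENNReal.ofReal_ne_top (h1.trans h)
  rw [ENNReal.toReal_mul, ENNReal.toReal_ofReal (Real.exp_pos _).le, ENNReal.toReal_ofReal hM] at h3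
  rw [Real.exp_neg, ← div_eq_inv_mul, le_div_iff₀ (Real.exp_pos _), mul_comm]
  exact h3

/-- The exponential moment of a sum of statistics of disjoint blocks. -/
theorem lintegral_exp_sum_blocks_le {ι κ : Type*} [Fintype ι] [Fintype κ] (P : Measure ℝ)
    [IsProbabilityMeasure P] {J : κ → Finset ι} (hJ : ∀ i j, i ≠ j → Disjoint (J i) (J j))
    {φ : κ → (ι → ℝ) → ℝ} (hφ : ∀ j, Measurable (φ j)) (hdep : ∀ j, DependsOn (φ j) (J j))
    {M : ℝ} (hM : 0 ≤ M)
    (h : ∀ j, ∫⁻ x, ENNReal.ofReal (Real.exp (φ j x)) ∂(Measure.pi fun _ : ι => P)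
      ≤ ENNReal.ofReal M) :
    ∫⁻ x, ENNReal.ofReal (Real.exp (∑ j, φ j x)) ∂(Measure.pi fun _ : ι => P)
      ≤ ENNReal.ofReal (M ^ Fintype.card κ) := by
  simp_rw [Real.exp_sum, ENNReal.ofReal_prod_of_nonneg fun _ _ => (Real.exp_pos _).le]
  rw [lintegral_prod_of_dependsOn P J hJ (fun j x => ENNReal.ofReal (Real.exp (φ j x)))
    (fun j => by have := hφ j; fun_prop) (fun j x y hxy => by simp only [hdep j hxy])]
  refine (Finset.prod_le_prod' fun j _ => h j).trans (le_of_eq ?_)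
  rw [Finset.prod_const, ENNReal.ofReal_pow hM, Finset.card_univ]

section Tails

variable {P : Measure ℝ} [IsProbabilityMeasure P] {ι : Type*} [Fintype ι]

theorem measureReal_selfNormSq_ge_le (hP : MemLp id 2 P) (hσ : 0 < stdDev P) {J : Finset ι}
    (hJ : J.Nonempty) :
    (Measure.pi fun _ : ι => P).real
        {x | (J.card : ℝ) / 5 ≤ selfNormSq (mean P) (stdDev P ^ 2) J x}
      ≤ Real.exp (-((J.card : ℝ) / 20)) * (5 / 4) := by
  refine le_trans (le_of_eq ?_) (measureReal_le_of_lintegral_exp_le _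
    (f := fun x => selfNormSq (mean P) (stdDev P ^ 2) J x / 4) (by fun_prop) (by norm_num)
    (lintegral_exp_selfNormSq_le hP hσ hJ) ((J.card : ℝ) / 20))
  congr 1
  ext x
  simp only [Set.mem_ofPred_eq]
  constructor <;> intro h <;> linarith

/-- The squared self-normalized sums of `k` disjoint blocks add up to `O(k + s)` with probability
at least `1 - exp (-s)`. -/
theorem measureReal_sum_selfNormSq_ge_le (hP : MemLp id 2 P) (hσ : 0 < stdDev P) {k : ℕ}
    {J : Fin k → Finset ι} (hdisj : ∀ i j, i ≠ j → Disjoint (J i) (J j))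
    (hJ : ∀ j, (J j).Nonempty) (s : ℝ) :
    (Measure.pi fun _ : ι => P).real
        {x | 4 * (k + s) ≤ ∑ j, selfNormSq (mean P) (stdDev P ^ 2) (J j) x}
      ≤ Real.exp (-s) := by
  have h := measureReal_le_of_lintegral_exp_le _
    (f := fun x => ∑ j, selfNormSq (mean P) (stdDev P ^ 2) (J j) x / 4) (by fun_prop)
    (by positivity)
    (lintegral_exp_sum_blocks_le P hdisj (fun j => by fun_prop)
      (fun j x y hxy => by simp only [dependsOn_selfNormSq _ _ _ hxy]) (by norm_num)
      fun j => lintegral_exp_selfNormSq_le hP hσ (hJ j)) (k + s)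
  refine (le_of_eq ?_).trans (h.trans ?_)
  · congr 1
    ext x
    simp only [Set.mem_ofPred_eq, ← Finset.sum_div]
    constructor <;> intro h <;> linarith
  · have h1 : ((5 : ℝ) / 4) ^ k ≤ Real.exp k := by
      rw [← mul_one (k : ℝ), Real.exp_nat_mul]
      exact pow_le_pow_left₀ (by norm_num)
        (le_trans (by norm_num) (Real.add_one_le_exp (1 : ℝ))) k
    rw [Fintype.card_fin, neg_add, Real.exp_add, Real.exp_neg (k : ℝ)]
    calc _ = Real.exp (-s) * ((Real.exp k)⁻¹ * (5 / 4) ^ k) := by ring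
      _ ≤ Real.exp (-s) * ((Real.exp k)⁻¹ * Real.exp k) := by gcongr
      _ = _ := by rw [inv_mul_cancel₀ (Real.exp_pos _).ne', mul_one]

/-- As `(1 - exp (-t Y²)) / t` increases to `Y²` when `t` decreases to `0`, the Laplace transform
of the squared deviation decays at a rate close to the variance for some `t`; how small `t` has to
be depends on the distribution. -/
theorem exists_lintegral_exp_neg_sq_le (hP : MemLp id 2 P) (hσ : 0 < stdDev P) :
    ∃ t : ℝ, 0 < t ∧ ∫⁻ y, ENNReal.ofReal (Real.exp (-(t * (y - mean P) ^ 2))) ∂P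
      ≤ ENNReal.ofReal (Real.exp (-(3 / 4 * t * stdDev P ^ 2))) := by
  let t : ℕ → ℝ := fun n => 1 / ((n : ℝ) + 1)
  have ht : ∀ n, 0 < t n := fun n => Nat.one_div_pos_of_nat
  let g : ℕ → ℝ → ℝ := fun n y => (1 - Real.exp (-(t n * (y - mean P) ^ 2))) / t n
  have hlim : Filter.Tendsto (fun n => ∫ y, g n y ∂P) Filter.atTop
      (nhds (∫ y, (y - mean P) ^ 2 ∂P)) := by
    refine tendsto_integral_of_dominated_convergence (fun y => (y - mean P) ^ 2)
      (fun n => by simp only [g]; fun_prop) (integrable_sub_mean_sq hP)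
      (fun n => ae_of_all _ fun y => ?_) (ae_of_all _ fun y => ?_)
    · have h1 := Real.add_one_le_exp (-(t n * (y - mean P) ^ 2))
      have h2 : Real.exp (-(t n * (y - mean P) ^ 2)) ≤ 1 :=
        Real.exp_le_one_iff.2 (by have := ht n; simp only [Left.neg_nonpos_iff]; positivity)
      rw [Real.norm_of_nonneg (div_nonneg (by linarith) (ht n).le), div_le_iff₀ (ht n)]
      linarith
    · have hd : HasDerivAt (fun u : ℝ => -Real.exp (-(u * (y - mean P) ^ 2)))
          ((y - mean P) ^ 2) 0 := by
        have := ((((hasDerivAt_id (0 : ℝ)).mul_const ((y - mean P) ^ 2)).neg).exp).neg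
        refine this.congr_deriv ?_
        simp
      have hs := hd.tendsto_slope_zero_right
      have ht0 : Filter.Tendsto t Filter.atTop (nhdsWithin 0 (Set.Ioi 0)) :=
        tendsto_nhdsWithin_iff.2 ⟨tendsto_one_div_add_atTop_nhds_zero_nat,
          Filter.Eventually.of_forall ht⟩
      refine (hs.comp ht0).congr fun n => ?_
      simp only [Function.comp, g, smul_eq_mul]
      rw [zero_add, zero_mul, neg_zero, Real.exp_zero, div_eq_inv_mul]
      ring
  rw [integral_sub_mean_sq hP] at hlim
  have hlt : 3 / 4 * stdDev P ^ 2 < stdDev P ^ 2 := by nlinarith [pow_pos hσ 2]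
  obtain ⟨n, hn⟩ := (hlim.eventually (lt_mem_nhds hlt)).exists
  refine ⟨t n, ht n, ?_⟩
  have hi : Integrable (fun y => Real.exp (-(t n * (y - mean P) ^ 2))) P := by
    refine Integrable.of_bound (by fun_prop) 1 (ae_of_all _ fun y => ?_)
    rw [Real.norm_of_nonneg (Real.exp_pos _).le]
    exact Real.exp_le_one_iff.2 (by have := ht n; simp only [Left.neg_nonpos_iff]; positivity)
  rw [← ofReal_integral_eq_lintegral_ofReal hi (ae_of_all _ fun y => (Real.exp_pos _).le)]
  refine ENNReal.ofReal_le_ofReal (le_trans ?_ (Real.add_one_le_exp _))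
  simp only [g] at hn
  rw [integral_div, integral_sub (integrable_const _) hi, lt_div_iff₀ (ht n)] at hn
  simp only [integral_const, probReal_univ, smul_eq_mul, mul_one] at hn
  linarith

/-- The second moment of a block falls below half of its expectation with an exponentially small
probability. -/
theorem exists_measureReal_devSq_le (hP : MemLp id 2 P) (hσ : 0 < stdDev P) :
    ∃ r : ℝ, 0 < r ∧ ∀ (m : ℕ) (J : Finset (Fin m)), (Measure.pi fun _ : Fin m => P).real
        {x | devSq (mean P) J x ≤ J.card * stdDev P ^ 2 / 2} ≤ Real.exp (-(r * J.card)) := by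
  obtain ⟨t, ht, h⟩ := exists_lintegral_exp_neg_sq_le hP hσ
  refine ⟨t * stdDev P ^ 2 / 4, by positivity, fun m J => ?_⟩
  have hm : Measurable fun y : ℝ => ENNReal.ofReal (Real.exp (-(t * (y - mean P) ^ 2))) := by
    fun_prop
  have h1 := lintegral_prod_eval P J hm
  simp_rw [← ENNReal.ofReal_prod_of_nonneg fun _ _ => (Real.exp_pos _).le, ← Real.exp_sum,
    Finset.sum_neg_distrib, ← Finset.mul_sum] at h1
  have h2 := measureReal_le_of_lintegral_exp_le (Measure.pi fun _ : Fin m => P)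
    (f := fun x => -(t * devSq (mean P) J x)) (by fun_prop) (Real.exp_pos _).le
    (M := Real.exp (J.card * -(3 / 4 * t * stdDev P ^ 2))) (by
      refine (le_of_eq h1).trans ((pow_le_pow_left₀ zero_le h _).trans (le_of_eq ?_))
      rw [← ENNReal.ofReal_pow (Real.exp_pos _).le, ← Real.exp_nat_mul])
    (-(t * (J.card * stdDev P ^ 2 / 2)))
  refine (le_of_eq ?_).trans (h2.trans (le_of_eq ?_))
  · congr 1
    ext x
    simp only [Set.mem_ofPred_eq, neg_le_neg_iff, mul_le_mul_iff_right₀ ht]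
  · rw [← Real.exp_add]
    congr 1
    ring

open Classical in
/-- Except with an exponentially small probability, fewer than three eighths of the blocks have a
second moment of at least four times the variance. For each block this has probability at most
`1 / 4`, by Markov's inequality. -/
theorem measureReal_card_devSq_ge_le (hP : MemLp id 2 P) (hσ : 0 < stdDev P) {k o : ℕ}
    (hk : 8 * o ≤ k) {J : Fin k → Finset ι} (hdisj : ∀ i j, i ≠ j → Disjoint (J i) (J j))
    (hJ : ∀ j, (J j).Nonempty) :
    (Measure.pi fun _ : ι => P).real
        {x | 3 * (k : ℝ) / 8 ≤ ((Finset.univ.filter fun j =>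
          4 * ((J j).card * stdDev P ^ 2) ≤ devSq (mean P) (J j) x).card : ℝ)}
      ≤ Real.exp (-((o : ℝ) / 4)) := by
  set Q := Measure.pi fun _ : ι => P
  let A : Fin k → Set (ι → ℝ) := fun j =>
    {x | 4 * ((J j).card * stdDev P ^ 2) ≤ devSq (mean P) (J j) x}
  have hA : ∀ j, MeasurableSet (A j) := fun j => measurableSet_le (by fun_prop) (by fun_prop)
  have hQA : ∀ j, Q (A j) ≤ ENNReal.ofReal (1 / 4) := fun j => by
    have hw : 0 < (J j).card * stdDev P ^ 2 :=
      mul_pos (Nat.cast_pos.2 (hJ j).card_pos) (pow_pos hσ 2)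
    have h := mul_meas_ge_le_lintegral (μ := Q)
      (f := fun x => ENNReal.ofReal (devSq (mean P) (J j) x)) (by fun_prop)
      (ENNReal.ofReal (4 * ((J j).card * stdDev P ^ 2)))
    rw [lintegral_devSq hP] at h
    have h2 : {x | ENNReal.ofReal (4 * ((J j).card * stdDev P ^ 2)) ≤
        ENNReal.ofReal (devSq (mean P) (J j) x)} = A j := by
      ext x
      rw [Set.mem_ofPred_eq, ENNReal.ofReal_le_ofReal_iff (devSq_nonneg _ _ _)]
      rfl
    have h3 : ENNReal.ofReal ((J j).card * stdDev P ^ 2) =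
        ENNReal.ofReal (4 * ((J j).card * stdDev P ^ 2)) * ENNReal.ofReal (1 / 4) := by
      rw [← ENNReal.ofReal_mul (by positivity)]
      congr 1
      ring
    rw [h2, h3] at h
    exact (ENNReal.mul_le_mul_iff_right (ENNReal.ofReal_pos.2 (by positivity)).ne'
      ENNReal.ofReal_ne_top).1 h
  let φ : Fin k → (ι → ℝ) → ℝ := fun j => (A j).indicator fun _ => Real.log 2
  have hφ : ∀ j, Measurable (φ j) := fun j => measurable_const.indicator (hA j)
  have hdep : ∀ j, DependsOn (φ j) (J j) := fun j x y hxy => by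
    simp only [φ, A, Set.indicator, Set.mem_ofPred_eq, dependsOn_devSq _ _ hxy]
  have hmom : ∀ j, ∫⁻ x, ENNReal.ofReal (Real.exp (φ j x)) ∂Q ≤ ENNReal.ofReal (5 / 4) := by
    intro j
    have e : ∀ x, ENNReal.ofReal (Real.exp (φ j x)) = 1 + (A j).indicator 1 x := fun x => by
      by_cases hx : x ∈ A j
      · simp only [φ, Set.indicator_of_mem hx, Real.exp_log two_pos, Pi.one_apply]
        norm_num
      · simp [φ, Set.indicator_of_notMem hx]
    simp_rw [e]
    rw [lintegral_add_left measurable_const, lintegral_indicator_one (hA j), lintegral_one,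
      measure_univ]
    refine (add_le_add le_rfl (hQA j)).trans (le_of_eq ?_)
    rw [← ENNReal.ofReal_one, ← ENNReal.ofReal_add (by norm_num) (by norm_num)]
    norm_num
  have h := measureReal_le_of_lintegral_exp_le Q (f := fun x => ∑ j, φ j x) (by fun_prop)
    (by positivity)
    (lintegral_exp_sum_blocks_le P hdisj hφ hdep (by norm_num) hmom) (3 * k / 8 * Real.log 2)
  refine (le_of_eq ?_).trans (h.trans ?_)
  · congr 1
    ext x
    have : ∑ j, φ j x = ((Finset.univ.filter fun j =>
          4 * ((J j).card * stdDev P ^ 2) ≤ devSq (mean P) (J j) x).card : ℝ) * Real.log 2 := by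
      simp only [φ, A, Set.indicator, Set.mem_ofPred_eq, ← Finset.sum_filter, Finset.sum_const,
        nsmul_eq_mul]
    simp only [Set.mem_ofPred_eq, this]
    exact (mul_le_mul_iff_left₀ (Real.log_pos one_lt_two)).symm
  · -- `(5 / 4) ^ 8 / 2 ^ 3 ≤ 3 / 4 ≤ exp (-1 / 4)`.
    have h1 : Real.log (5 / 4) * 8 ≤ 3 * Real.log 2 - 1 / 4 := by
      have h2 : (5 / 4 : ℝ) ^ 8 ≤ 2 ^ 3 * (3 / 4) := by norm_num
      have h3 := Real.log_le_log (by norm_num) h2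
      rw [Real.log_mul (by norm_num) (by norm_num), Real.log_pow, Real.log_pow] at h3
      have h4 : Real.log (3 / 4) ≤ 3 / 4 - 1 := Real.log_le_sub_one_of_pos (by norm_num)
      push_cast at h3
      linarith
    have h5 : ((5 : ℝ) / 4) ^ Fintype.card (Fin k) = Real.exp (k * Real.log (5 / 4)) := by
      rw [Real.exp_nat_mul, Real.exp_log (by norm_num), Fintype.card_fin]
    rw [h5, ← Real.exp_add, Real.exp_le_exp]
    have hk' : 8 * (o : ℝ) ≤ k := by exact_mod_cast hk
    have : (0 : ℝ) ≤ o := Nat.cast_nonneg o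
    nlinarith

end Tails

/-! ### Random permutations -/

section Permutations

variable {α : Type*} [Fintype α] [DecidableEq α]

/-- Sampling without replacement: prescribing one more image in `O` costs a factor `|O| / |α|`. -/
theorem card_perm_mapsTo_insert_le (O B : Finset α) {b : α} (hb : b ∉ B) :
    Fintype.card α * (Finset.univ.filter fun ρ : Equiv.Perm α => ∀ i ∈ insert b B, ρ i ∈ O).card
      ≤ O.card * (Finset.univ.filter fun ρ : Equiv.Perm α => ∀ i ∈ B, ρ i ∈ O).card := by
  let F : Finset α → Finset (Equiv.Perm α) := fun B =>
    Finset.univ.filter fun ρ => ∀ i ∈ B, ρ i ∈ O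
  -- The number of permutations does not depend on the inserted element.
  have hsymm : ∀ a, a ∉ B → (F (insert a B)).card = (F (insert b B)).card := fun a ha => by
    refine Finset.card_bij' (fun ρ _ => ρ * Equiv.swap a b) (fun ρ _ => ρ * Equiv.swap a b)
      ?_ ?_ ?_ ?_
    · intro ρ hρ
      simp only [F, Finset.mem_filter, Finset.mem_univ, true_and, Finset.forall_mem_insert,
        Equiv.Perm.mul_apply, Equiv.swap_apply_right] at hρ ⊢
      refine ⟨hρ.1, fun i hi => ?_⟩
      rw [Equiv.swap_apply_of_ne_of_ne (ne_of_mem_of_not_mem hi ha) (ne_of_mem_of_not_mem hi hb)]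
      exact hρ.2 i hi
    · intro ρ hρ
      simp only [F, Finset.mem_filter, Finset.mem_univ, true_and, Finset.forall_mem_insert,
        Equiv.Perm.mul_apply, Equiv.swap_apply_left] at hρ ⊢
      refine ⟨hρ.1, fun i hi => ?_⟩
      rw [Equiv.swap_apply_of_ne_of_ne (ne_of_mem_of_not_mem hi ha) (ne_of_mem_of_not_mem hi hb)]
      exact hρ.2 i hi
    · intro ρ _
      simp [mul_assoc]
    · intro ρ _
      simp [mul_assoc]
  -- Count the pairs of a permutation in `F B` and an element outside of `B` mapped into `O`.
  have hcount : ∑ a ∈ Bᶜ, (F (insert a B)).card = ∑ ρ ∈ F B, (Bᶜ.filter fun a => ρ a ∈ O).card := by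
    have e : ∀ a, F (insert a B) = (F B).filter fun ρ => ρ a ∈ O := fun a => by
      ext ρ
      simp only [F, Finset.mem_filter, Finset.mem_univ, true_and, Finset.forall_mem_insert]
      exact and_comm
    simp_rw [e]
    exact Finset.sum_card_bipartiteAbove_eq_sum_card_bipartiteBelow
      (r := fun (a : α) (ρ : Equiv.Perm α) => ρ a ∈ O) (s := Bᶜ) (t := F B)
  rw [Finset.sum_congr rfl fun a ha => hsymm a (Finset.mem_compl.1 ha), Finset.sum_const,
    smul_eq_mul] at hcount
  have hin : ∀ ρ ∈ F B, (Bᶜ.filter fun a => ρ a ∈ O).card + B.card = O.card := fun ρ hρ => by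
    have h1 : (Finset.univ.filter fun a => ρ a ∈ O).card = O.card := by
      rw [← Finset.card_map ρ.symm.toEmbedding (s := O)]
      congr 1
      ext a
      simp [Finset.mem_map_equiv]
    rw [← h1, ← Finset.card_union_of_disjoint]
    · congr 1
      ext a
      simp only [F, Finset.mem_filter, Finset.mem_univ, true_and] at hρ
      simp only [Finset.mem_union, Finset.mem_filter, Finset.mem_compl, Finset.mem_univ, true_and]
      by_cases h : a ∈ B
      · simp [h, hρ a h]
      · simp [h]
    · rw [Finset.disjoint_left]
      intro a ha
      exact Finset.mem_compl.1 (Finset.mem_filter.1 ha).1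
  have hsum : Bᶜ.card * (F (insert b B)).card + B.card * (F B).card = O.card * (F B).card := by
    rw [hcount, mul_comm B.card, mul_comm O.card, ← smul_eq_mul, ← Finset.sum_const,
      ← Finset.sum_add_distrib, Finset.sum_congr rfl hin, Finset.sum_const, smul_eq_mul]
  have hmono : (F (insert b B)).card ≤ (F B).card := by
    refine Finset.card_le_card fun ρ hρ => ?_
    simp only [F, Finset.mem_filter, Finset.mem_univ, true_and, Finset.forall_mem_insert] at hρ ⊢
    exact hρ.2
  calc Fintype.card α * (F (insert b B)).card
      = Bᶜ.card * (F (insert b B)).card + B.card * (F (insert b B)).card := by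
        rw [← add_mul, add_comm, Finset.card_add_card_compl]
    _ ≤ Bᶜ.card * (F (insert b B)).card + B.card * (F B).card := by gcongr
    _ = _ := hsum

theorem four_pow_mul_card_perm_mapsTo_le {O : Finset α} (hO : 4 * O.card ≤ Fintype.card α)
    (B : Finset α) :
    4 ^ B.card * (Finset.univ.filter fun ρ : Equiv.Perm α => ∀ i ∈ B, ρ i ∈ O).card
      ≤ Fintype.card (Equiv.Perm α) := by
  induction B using Finset.induction_on with
  | empty => simp
  | insert b B hb ih =>
    refine le_trans ?_ ih
    rw [Finset.card_insert_of_notMem hb, pow_succ, mul_assoc]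
    refine Nat.mul_le_mul_left _ ?_
    have h := card_perm_mapsTo_insert_le O B hb
    rcases Nat.eq_zero_or_pos O.card with h0 | h0
    · have : Fintype.card α ≠ 0 := (Fintype.card_pos_iff.2 ⟨b⟩).ne'
      rw [h0, zero_mul] at h
      have := (Nat.mul_eq_zero.1 (Nat.le_zero.1 h)).resolve_left this
      omega
    · have h1 := (Nat.mul_le_mul_right
        (Finset.univ.filter fun ρ : Equiv.Perm α => ∀ i ∈ insert b B, ρ i ∈ O).card hO).trans h
      rw [mul_comm 4, mul_assoc] at h1
      exact Nat.le_of_mul_le_mul_left h1 h0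

/-- If at most a quarter of the points is marked, a random permutation maps more than three
quarters of a given set to marked points with an exponentially small probability. This is a union
bound over the subsets of the given set. -/
theorem card_perm_many_marked_le {O : Finset α} (hO : 4 * O.card ≤ Fintype.card α) (G : Finset α) :
    ((Finset.univ.filter fun ρ : Equiv.Perm α =>
        3 * G.card < 4 * (G.filter fun i => ρ i ∈ O).card).card : ℝ)
      ≤ Real.exp (-((G.card : ℝ) / 4)) * Fintype.card (Equiv.Perm α) := by
  set M : ℝ := (Fintype.card (Equiv.Perm α) : ℝ)
  let F : Finset α → Finset (Equiv.Perm α) := fun B =>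
    Finset.univ.filter fun ρ => ∀ i ∈ B, ρ i ∈ O
  let U := G.powerset.filter fun B => 3 * G.card < 4 * B.card
  have hsub : (Finset.univ.filter fun ρ : Equiv.Perm α =>
      3 * G.card < 4 * (G.filter fun i => ρ i ∈ O).card) ⊆ U.biUnion F := fun ρ hρ => by
    simp only [Finset.mem_filter, Finset.mem_univ, true_and] at hρ
    refine Finset.mem_biUnion.2 ⟨G.filter fun i => ρ i ∈ O, ?_, ?_⟩
    · exact Finset.mem_filter.2 ⟨Finset.mem_powerset.2 (Finset.filter_subset _ _), hρ⟩
    · simp only [F, Finset.mem_filter, Finset.mem_univ, true_and]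
      exact fun i hi => hi.2
  have h2 : (1 : ℝ) / 2 ≤ Real.log 2 := by linarith [Real.log_two_gt_d9]
  have hF : ∀ B ∈ U, ((F B).card : ℝ) ≤ Real.exp (-(3 / 2 * G.card * Real.log 2)) * M := by
    intro B hB
    have h3 : 3 * (G.card : ℝ) ≤ 4 * B.card := by
      exact_mod_cast (Finset.mem_filter.1 hB).2.le
    have h4 : (4 : ℝ) ^ B.card * (F B).card ≤ M := by
      have := four_pow_mul_card_perm_mapsTo_le hO B
      simp only [M, F]
      exact_mod_cast this
    have h5 : (4 : ℝ) ^ B.card = Real.exp (2 * B.card * Real.log 2) := by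
      rw [show (4 : ℝ) = 2 ^ 2 by norm_num, ← pow_mul, ← Real.exp_log (two_pos),
        ← Real.exp_nat_mul, Real.exp_log two_pos]
      push_cast
      rfl
    rw [h5] at h4
    calc ((F B).card : ℝ) = Real.exp (-(2 * B.card * Real.log 2)) *
          (Real.exp (2 * B.card * Real.log 2) * (F B).card) := by
          rw [← mul_assoc, ← Real.exp_add, neg_add_cancel, Real.exp_zero, one_mul]
      _ ≤ Real.exp (-(3 / 2 * G.card * Real.log 2)) * M := by
          refine mul_le_mul (Real.exp_le_exp.2 ?_) h4 (by positivity) (Real.exp_pos _).le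
          nlinarith
  have hU : (U.card : ℝ) ≤ Real.exp (G.card * Real.log 2) := by
    rw [Real.exp_nat_mul, Real.exp_log two_pos]
    have : U.card ≤ 2 ^ G.card := by
      rw [← Finset.card_powerset]
      exact Finset.card_filter_le _ _
    exact_mod_cast this
  calc _ ≤ ((U.biUnion F).card : ℝ) := by exact_mod_cast Finset.card_le_card hsub
    _ ≤ ∑ B ∈ U, ((F B).card : ℝ) := by exact_mod_cast Finset.card_biUnion_le
    _ ≤ U.card * (Real.exp (-(3 / 2 * G.card * Real.log 2)) * M) := by
        rw [← nsmul_eq_mul]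
        exact Finset.sum_le_card_nsmul _ _ _ hF
    _ ≤ Real.exp (G.card * Real.log 2) * (Real.exp (-(3 / 2 * G.card * Real.log 2)) * M) := by
        gcongr
    _ = Real.exp (-(1 / 2 * G.card * Real.log 2)) * M := by
        rw [← mul_assoc, ← Real.exp_add]
        congr 2
        ring
    _ ≤ _ := by
        gcongr
        have : (0 : ℝ) ≤ G.card := Nat.cast_nonneg _
        nlinarith

end Permutations

/-! ### Deterministic bounds for a block with outliers -/

section Blocks

variable {N : ℕ}

theorem card_mul_blockStd_sq {B : Finset (Fin N)} (hB : B.Nonempty) (z : Fin N → ℝ) :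
    B.card * blockStd z B ^ 2 = ∑ i ∈ B, (z i - blockMean z B) ^ 2 := by
  have : (0 : ℝ) < B.card := Nat.cast_pos.2 hB.card_pos
  rw [blockStd, Real.sq_sqrt (by positivity), mul_div_cancel₀ _ this.ne']

theorem sum_sub_sq_eq (I : Finset (Fin N)) (z : Fin N → ℝ) (a b : ℝ) :
    ∑ i ∈ I, (z i - b) ^ 2 = devSq a I z - 2 * (b - a) * devSum a I z + I.card * (b - a) ^ 2 := by
  have h : ∀ i ∈ I, (z i - b) ^ 2 =
      (z i - a) ^ 2 - 2 * (b - a) * (z i - a) + (b - a) ^ 2 := fun i _ => by ring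
  rw [Finset.sum_congr rfl h, Finset.sum_add_distrib, Finset.sum_sub_distrib, ← Finset.mul_sum,
    Finset.sum_const, nsmul_eq_mul]
  rfl

theorem card_mul_blockMean_sub {B : Finset (Fin N)} (hB : B.Nonempty) (z : Fin N → ℝ) (a : ℝ) :
    B.card * (blockMean z B - a) = devSum a B z := by
  have : (0 : ℝ) < B.card := Nat.cast_pos.2 hB.card_pos
  rw [blockMean, devSum, Finset.sum_sub_distrib, Finset.sum_const, nsmul_eq_mul, mul_sub,
    mul_div_cancel₀ _ this.ne']

theorem card_mul_blockStd_sq_le {B : Finset (Fin N)} (hB : B.Nonempty) (z : Fin N → ℝ) (a : ℝ) :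
    B.card * blockStd z B ^ 2 ≤ devSq a B z := by
  rw [card_mul_blockStd_sq hB, sum_sub_sq_eq B z a, ← card_mul_blockMean_sub hB z a]
  have : (0 : ℝ) ≤ B.card * (blockMean z B - a) ^ 2 := by positivity
  linarith

variable {B I : Finset (Fin N)} {z : Fin N → ℝ} {a σ : ℝ}

theorem devSq_sub_le_card_mul_blockStd_sq (hIB : I ⊆ B) (hI : I.Nonempty) :
    devSq a I z - devSum a I z ^ 2 / I.card ≤ B.card * blockStd z B ^ 2 := by
  have hq : (0 : ℝ) < I.card := Nat.cast_pos.2 hI.card_pos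
  rw [card_mul_blockStd_sq (hI.mono hIB)]
  refine le_trans ?_ (Finset.sum_le_sum_of_subset_of_nonneg hIB fun _ _ _ => sq_nonneg _)
  rw [sum_sub_sq_eq I z a]
  have : devSq a I z - 2 * (blockMean z B - a) * devSum a I z +
      I.card * (blockMean z B - a) ^ 2 - (devSq a I z - devSum a I z ^ 2 / I.card) =
      I.card * (blockMean z B - a - devSum a I z / I.card) ^ 2 := by
    field_simp
    ring
  have h2 : 0 ≤ I.card * (blockMean z B - a - devSum a I z / I.card) ^ 2 := by positivity
  linarith

/-- By the Cauchy-Schwarz inequality, the mean of a subset differs from the mean of the block by at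
most a multiple of the standard deviation of the block, however large the removed data are. -/
theorem abs_card_mul_blockMean_sub_le (hIB : I ⊆ B) (hI : I.Nonempty) :
    I.card * |blockMean z B - a| ≤
      |devSum a I z| + √((B \ I).card) * (√(B.card) * blockStd z B) := by
  have hB := hI.mono hIB
  have h1 : ∑ i ∈ B, (z i - blockMean z B) = 0 := by
    have := card_mul_blockMean_sub hB z (blockMean z B)
    rw [sub_self, mul_zero] at this
    exact this.symm
  have h2 : ∑ i ∈ I, (z i - blockMean z B) = devSum a I z - I.card * (blockMean z B - a) := by
    rw [devSum, Finset.sum_sub_distrib, Finset.sum_sub_distrib, Finset.sum_const, Finset.sum_const,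
      nsmul_eq_mul, nsmul_eq_mul]
    ring
  have h3 : I.card * (blockMean z B - a) =
      devSum a I z + ∑ i ∈ B \ I, (z i - blockMean z B) := by
    have := Finset.sum_sdiff hIB (f := fun i => z i - blockMean z B)
    linarith
  have h4 : |∑ i ∈ B \ I, (z i - blockMean z B)| ≤
      √((B \ I).card) * (√(B.card) * blockStd z B) := by
    have h5 := sq_sum_le_card_mul_sum_sq (s := B \ I) (f := fun i => z i - blockMean z B)
    have h6 : ∑ i ∈ B \ I, (z i - blockMean z B) ^ 2 ≤ B.card * blockStd z B ^ 2 := by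
      rw [card_mul_blockStd_sq hB]
      exact Finset.sum_le_sum_of_subset_of_nonneg Finset.sdiff_subset fun _ _ _ => sq_nonneg _
    have h7 : 0 ≤ blockStd z B := Real.sqrt_nonneg _
    refine abs_le_of_sq_le_sq ?_ (by positivity)
    rw [mul_pow, mul_pow, Real.sq_sqrt (by positivity), Real.sq_sqrt (by positivity)]
    exact h5.trans (by gcongr)
  calc (I.card : ℝ) * |blockMean z B - a| = |I.card * (blockMean z B - a)| := by
        rw [abs_mul, Nat.abs_cast]
    _ ≤ _ := by
        rw [h3]
        exact (abs_add_le _ _).trans (by gcongr)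

theorem devSum_sq_eq (hσ : 0 < σ) (hI : I.Nonempty) :
    devSum a I z ^ 2 =
      selfNormSq a (σ ^ 2) I z * (devSq a I z / 3 + 5 / 3 * (I.card * σ ^ 2)) := by
  have hq : (0 : ℝ) < I.card := Nat.cast_pos.2 hI.card_pos
  have := devSq_nonneg a I z
  rw [selfNormSq, div_mul_cancel₀]
  positivity

/-- A block of which a quarter `I` is well behaved has a standard deviation comparable to `σ` from
below: the outliers can only add to the sum of squares around the block mean. -/
theorem div_six_le_blockStd (hσ : 0 < σ) (hIB : I ⊆ B) (hI : I.Nonempty)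
    (hcard : B.card ≤ 4 * I.card) (hV : I.card * σ ^ 2 / 2 ≤ devSq a I z)
    (hT : selfNormSq a (σ ^ 2) I z ≤ (I.card : ℝ) / 5) : σ / 6 ≤ blockStd z B := by
  have hq : (0 : ℝ) < I.card := Nat.cast_pos.2 hI.card_pos
  have hn : (0 : ℝ) < B.card := Nat.cast_pos.2 (hI.mono hIB).card_pos
  have hc : (B.card : ℝ) ≤ 4 * I.card := by exact_mod_cast hcard
  have h1 := devSq_sub_le_card_mul_blockStd_sq (a := a) (z := z) hIB hI
  have h2 := devSum_sq_eq (a := a) (z := z) hσ hI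
  have hV0 := devSq_nonneg a I z
  have h3 : devSum a I z ^ 2 / I.card ≤ (devSq a I z / 3 + 5 / 3 * (I.card * σ ^ 2)) / 5 := by
    rw [h2, div_le_iff₀ hq]
    have h4 : 0 ≤ devSq a I z / 3 + 5 / 3 * (I.card * σ ^ 2) := by positivity
    nlinarith [mul_le_mul_of_nonneg_right hT h4]
  have h5 : B.card * (σ ^ 2 / 30) ≤ B.card * blockStd z B ^ 2 := by
    have : (B.card : ℝ) * σ ^ 2 ≤ 4 * I.card * σ ^ 2 := by gcongr
    linarith
  have h6 := le_of_mul_le_mul_left h5 hn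
  refine le_of_sq_le_sq ?_ (Real.sqrt_nonneg _)
  have : 0 < σ ^ 2 := pow_pos hσ 2
  have e : (σ / 6) ^ 2 = σ ^ 2 / 36 := by ring
  rw [e]
  exact le_trans (by linarith) h6

/-- The deviation of a block mean is at most a multiple of the sample standard deviation: the
outliers contribute the square root of their number, the other data their self-normalized sum. -/
theorem abs_blockMean_sub_le (hσ : 0 < σ) (hIB : I ⊆ B) (hI : I.Nonempty)
    (hcard : B.card ≤ 4 * I.card) (hV : I.card * σ ^ 2 / 2 ≤ devSq a I z)
    (hT : selfNormSq a (σ ^ 2) I z ≤ (I.card : ℝ) / 5) :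
    |blockMean z B - a| ≤
      36 * blockStd z B * ((√((B \ I).card) + √(selfNormSq a (σ ^ 2) I z)) / √(B.card)) := by
  have hq : (0 : ℝ) < I.card := Nat.cast_pos.2 hI.card_pos
  have hn : (0 : ℝ) < B.card := Nat.cast_pos.2 (hI.mono hIB).card_pos
  have hc : (B.card : ℝ) ≤ 4 * I.card := by exact_mod_cast hcard
  have hqn : (I.card : ℝ) ≤ B.card := by exact_mod_cast Finset.card_le_card hIB
  have hstd := div_six_le_blockStd hσ hIB hI hcard hV hT
  have hstd0 : 0 < blockStd z B := lt_of_lt_of_le (by positivity) hstd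
  have h1 := devSq_sub_le_card_mul_blockStd_sq (a := a) (z := z) hIB hI
  have h2 := devSum_sq_eq (a := a) (z := z) hσ hI
  set T := selfNormSq a (σ ^ 2) I z
  set S := devSum a I z
  set V := devSq a I z
  set d := blockStd z B
  set n : ℝ := (B.card : ℝ)
  set q : ℝ := (I.card : ℝ)
  have hT0 : 0 ≤ T := selfNormSq_nonneg a (sq_nonneg σ) I z
  have hS : |S| ≤ 9 * √T * (√n * d) := by
    refine abs_le_of_sq_le_sq ?_ (by positivity)
    have e : (9 * √T * (√n * d)) ^ 2 = 81 * T * (n * d ^ 2) := by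
      rw [mul_pow, mul_pow, mul_pow, Real.sq_sqrt hT0, Real.sq_sqrt hn.le]
      ring
    rw [e]
    have h3 : T * (S ^ 2 / q) ≤ S ^ 2 / 5 := by
      rw [mul_div_assoc', div_le_iff₀ hq]
      nlinarith [mul_le_mul_of_nonneg_right hT (sq_nonneg S)]
    have hσd : σ ^ 2 ≤ 36 * d ^ 2 := by nlinarith
    have h4 : q * σ ^ 2 ≤ 36 * (n * d ^ 2) := by
      calc q * σ ^ 2 ≤ n * (36 * d ^ 2) := by gcongr
        _ = _ := by ring
    have h5 : V / 3 + 5 / 3 * (q * σ ^ 2) ≤ 61 * (n * d ^ 2) + S ^ 2 / q / 3 := by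
      have : 0 ≤ n * d ^ 2 := by positivity
      linarith
    have h6 : S ^ 2 ≤ 61 * (T * (n * d ^ 2)) + T * (S ^ 2 / q) / 3 := by
      calc S ^ 2 = T * (V / 3 + 5 / 3 * (q * σ ^ 2)) := h2
        _ ≤ T * (61 * (n * d ^ 2) + S ^ 2 / q / 3) := by gcongr
        _ = _ := by ring
    have h7 : 0 ≤ T * (n * d ^ 2) := by positivity
    linarith
  have h8 := abs_card_mul_blockMean_sub_le (a := a) (z := z) hIB hI
  have hsn : 0 < √n := Real.sqrt_pos.2 hn
  have hnn : √n * √n = n := Real.mul_self_sqrt hn.le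
  rw [mul_div_assoc', le_div_iff₀ hsn]
  have h9 : n * |blockMean z B - a| ≤
      4 * (9 * √T * (√n * d) + √((B \ I).card) * (√n * d)) := by
    calc n * |blockMean z B - a| ≤ 4 * q * |blockMean z B - a| := by gcongr
      _ = 4 * (q * |blockMean z B - a|) := by ring
      _ ≤ _ := by linarith
  have h10 : √n * (|blockMean z B - a| * √n) ≤
      √n * (36 * d * (√((B \ I).card) + √T)) := by
    have : 0 ≤ √((B \ I).card : ℝ) * (√n * d) := by positivity
    calc √n * (|blockMean z B - a| * √n) = √n * √n * |blockMean z B - a| := by ring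
      _ = n * |blockMean z B - a| := by rw [hnn]
      _ ≤ 36 * (√T * (√n * d)) + 36 * (√((B \ I).card) * (√n * d)) := by linarith
      _ = _ := by ring
  exact le_of_mul_le_mul_left h10 hsn

end Blocks

/-- The weights `d j ^ (-p) / ∑ d l ^ (-p)` times `d j` are at most of the order `σ / k` when all
`d j` are at least of the order `σ` and the harmonic mean of the `d j ^ p` is at most of the order
`σ ^ p`. This is where `p ≥ 1` is used. -/
theorem weight_mul_le {k : ℕ} (hk : 0 < k) {d : Fin k → ℝ} {σ L p : ℝ} (hσ : 0 < σ) (hL : 0 < L)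
    (hp : 1 ≤ p) (hd : ∀ j, σ / 6 ≤ d j)
    (htest : ((1 / (k : ℝ)) * ∑ j, 1 / d j ^ p)⁻¹ ≤ (L * σ) ^ p) (j : Fin k) :
    (1 / d j ^ p) / (∑ l, 1 / d l ^ p) * d j ≤ (6 * L) ^ p * σ / k := by
  have hd0 : ∀ j, 0 < d j := fun j => lt_of_lt_of_le (by positivity) (hd j)
  have hk0 : (0 : ℝ) < k := Nat.cast_pos.2 hk
  have hsum : 0 < ∑ l, 1 / d l ^ p :=
    Finset.sum_pos (fun l _ => one_div_pos.2 (Real.rpow_pos_of_pos (hd0 l) p))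
      ⟨j, Finset.mem_univ _⟩
  have h1 : (∑ l, 1 / d l ^ p)⁻¹ ≤ (L * σ) ^ p / k := by
    rw [mul_inv, one_div, inv_inv] at htest
    rw [le_div_iff₀ hk0, mul_comm]
    exact htest
  have h2 : 1 / d j ^ p * d j ≤ 6 ^ p * (σ / σ ^ p) := by
    have h3 : 1 / d j ^ p * d j = d j ^ (1 - p) := by
      rw [Real.rpow_sub (hd0 j), Real.rpow_one]
      ring
    have h4 : d j ^ (1 - p) ≤ (σ / 6) ^ (1 - p) :=
      Real.rpow_le_rpow_of_nonpos (by positivity) (hd j) (by linarith)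
    have h5 : (σ / 6) ^ (1 - p) = 6 ^ p * (σ / σ ^ p) / 6 := by
      rw [Real.rpow_sub (by positivity), Real.rpow_one, Real.div_rpow hσ.le (by norm_num)]
      have := Real.rpow_pos_of_pos hσ p
      have := Real.rpow_pos_of_pos (show (0 : ℝ) < 6 by norm_num) p
      field_simp
    have h6 : 0 ≤ 6 ^ p * (σ / σ ^ p) := by positivity
    rw [h3]
    linarith
  calc (1 / d j ^ p) / (∑ l, 1 / d l ^ p) * d j
      = (1 / d j ^ p * d j) * (∑ l, 1 / d l ^ p)⁻¹ := by ring
    _ ≤ 6 ^ p * (σ / σ ^ p) * ((L * σ) ^ p / k) := by gcongr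
    _ = _ := by
        rw [Real.mul_rpow hL.le hσ.le, Real.mul_rpow (by norm_num) hL.le]
        have := Real.rpow_pos_of_pos hσ p
        field_simp

/-! ### Deterministic bounds for the weighted average and the choice of the number of blocks -/

theorem sum_sqrt_le {k : ℕ} {u : Fin k → ℝ} (hu : ∀ j, 0 ≤ u j) {b : ℝ} (hb : ∑ j, u j ≤ b) :
    ∑ j, √(u j) ≤ √k * √b := by
  rw [← Real.sqrt_mul (Nat.cast_nonneg k)]
  refine Real.le_sqrt_of_sq_le ?_
  have h := sq_sum_le_card_mul_sum_sq (s := Finset.univ) (f := fun j => √(u j))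
  simp only [Real.sq_sqrt (hu _), Finset.card_univ, Fintype.card_fin] at h
  exact h.trans (by gcongr)

theorem IsBlockPartition.le_mul_card {N k : ℕ} {G : Fin k → Finset (Fin N)}
    (hG : IsBlockPartition G) (hk : 0 < k) (hkN : k ≤ N) (j : Fin k) :
    0 < (G j).card ∧ N ≤ 2 * k * (G j).card := by
  have h1 := hG.le_card j
  have h2 : 0 < N / k := Nat.div_pos hkN hk
  have h3 := Nat.lt_mul_div_succ N hk
  refine ⟨by omega, ?_⟩
  calc N ≤ k * (N / k + 1) := h3.le
    _ ≤ k * (2 * (G j).card) := Nat.mul_le_mul_left _ (by omega)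
    _ = _ := by ring

theorem sum_sqrt_add_sqrt_le {N k o : ℕ} (hk : 0 < k) (hko : k ≤ 16 * o) {s D σ : ℝ} (hs : 0 ≤ s)
    (hD : 0 ≤ D) (hσ : 0 ≤ σ) {r T : Fin k → ℝ} (hr0 : ∀ j, 0 ≤ r j) (hT0 : ∀ j, 0 ≤ T j)
    (hr : ∑ j, r j ≤ o) (hT : ∑ j, T j ≤ 4 * (k + s)) :
    ∑ j, 36 * (D * σ / k * (√(2 * k) / √N)) * (√(r j) + √(T j)) ≤
      700 * D * σ * (√(s / N) + √(o / N)) := by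
  have hk0 : (0 : ℝ) < k := Nat.cast_pos.2 hk
  have hrs : ∑ j, √(r j) ≤ √k * √o := sum_sqrt_le hr0 hr
  have hTs : ∑ j, √(T j) ≤ √k * √(4 * (k + s)) := sum_sqrt_le hT0 hT
  have h5 : √(4 * (k + s)) ≤ 8 * √o + 2 * √s := by
    refine Real.sqrt_le_iff.2 ⟨by positivity, ?_⟩
    have h6 : (k : ℝ) ≤ 16 * o := by exact_mod_cast hko
    have h7 := Real.sq_sqrt (Nat.cast_nonneg (α := ℝ) o)
    have h8 := Real.sq_sqrt hs
    nlinarith [mul_nonneg (Real.sqrt_nonneg (o : ℝ)) (Real.sqrt_nonneg s)]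
  have h9 : √(2 * k) * √k ≤ 2 * k := by
    rw [Real.sqrt_mul (by norm_num), mul_assoc, Real.mul_self_sqrt hk0.le]
    gcongr
    exact Real.sqrt_le_iff.2 ⟨by norm_num, by norm_num⟩
  have h10 : 0 ≤ √(o : ℝ) := Real.sqrt_nonneg _
  have h11 : 0 ≤ √s := Real.sqrt_nonneg _
  have h12 : 0 ≤ D * σ / k / √N := by positivity
  rw [← Finset.mul_sum, Finset.sum_add_distrib, Real.sqrt_div hs, Real.sqrt_div (Nat.cast_nonneg o)]
  calc 36 * (D * σ / k * (√(2 * k) / √N)) * (∑ j, √(r j) + ∑ j, √(T j))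
      ≤ 36 * (D * σ / k * (√(2 * k) / √N)) * (√k * √o + √k * (8 * √o + 2 * √s)) := by
        refine mul_le_mul_of_nonneg_left (add_le_add hrs (hTs.trans ?_)) (by positivity)
        exact mul_le_mul_of_nonneg_left h5 (Real.sqrt_nonneg _)
    _ = 36 * (D * σ / k / √N) * (√(2 * k) * √k) * (9 * √o + 2 * √s) := by ring
    _ ≤ 36 * (D * σ / k / √N) * (2 * k) * (9 * √o + 2 * √s) := by
        refine mul_le_mul_of_nonneg_right (mul_le_mul_of_nonneg_left h9 ?_) ?_ <;> positivity
    _ = D * σ / √N * (648 * √o + 144 * √s) := by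
        have e : D * σ / k / √N * k = D * σ / √N := by
          rw [div_right_comm, div_mul_cancel₀ _ hk0.ne']
        linear_combination (648 * √o + 144 * √s) * e
    _ ≤ D * σ / √N * (700 * (√s + √o)) := by
        refine mul_le_mul_of_nonneg_left ?_ (by positivity)
        linarith
    _ = _ := by ring

/-- The error bound for a fixed number of blocks, deterministic given that each block contains a
well-behaved quarter `I j` and that the scale test is passed. -/
theorem abs_blockEstimator_sub_le {N k o : ℕ} (hk : 0 < k) (hkN : k ≤ N) (hko : k ≤ 16 * o)
    {G I : Fin k → Finset (Fin N)} (hG : IsBlockPartition G) {z : Fin N → ℝ} {a σ L p s : ℝ}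
    (hσ : 0 < σ) (hL : 0 < L) (hp : 1 ≤ p) (hs : 0 ≤ s)
    (hIG : ∀ j, I j ⊆ G j) (hI : ∀ j, (I j).Nonempty) (hcard : ∀ j, (G j).card ≤ 4 * (I j).card)
    (hV : ∀ j, (I j).card * σ ^ 2 / 2 ≤ devSq a (I j) z)
    (hT : ∀ j, selfNormSq a (σ ^ 2) (I j) z ≤ ((I j).card : ℝ) / 5)
    (hout : ∑ j, ((G j \ I j).card : ℝ) ≤ o)
    (hTsum : ∑ j, selfNormSq a (σ ^ 2) (I j) z ≤ 4 * (k + s))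
    (htest : ((1 / (k : ℝ)) * ∑ j, 1 / blockStd z (G j) ^ p)⁻¹ ≤ (L * σ) ^ p) :
    |blockEstimator p z G - a| ≤ 700 * (6 * L) ^ p * σ * (√(s / N) + √(o / N)) := by
  have hk0 : (0 : ℝ) < k := Nat.cast_pos.2 hk
  have hN0 : (0 : ℝ) < N := Nat.cast_pos.2 (hk.trans_le hkN)
  have hd : ∀ j, σ / 6 ≤ blockStd z (G j) := fun j =>
    div_six_le_blockStd hσ (hIG j) (hI j) (hcard j) (hV j) (hT j)
  have hd0 : ∀ j, 0 < blockStd z (G j) := fun j => lt_of_lt_of_le (by positivity) (hd j)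
  have hi0 : ∀ j, 0 < 1 / blockStd z (G j) ^ p := fun j =>
    one_div_pos.2 (Real.rpow_pos_of_pos (hd0 j) p)
  have hsum : 0 < ∑ l, 1 / blockStd z (G l) ^ p :=
    Finset.sum_pos (fun l _ => hi0 l) ⟨⟨0, hk⟩, Finset.mem_univ _⟩
  have hw0 : ∀ j, 0 ≤ blockWeight p z G j := fun j => (div_pos (hi0 j) hsum).le
  have hw1 : ∑ j, blockWeight p z G j = 1 := by
    simp only [blockWeight]
    rw [← Finset.sum_div, div_self hsum.ne']
  have herr : blockEstimator p z G - a =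
      ∑ j, blockWeight p z G j * (blockMean z (G j) - a) := by
    simp only [blockEstimator, mul_sub, Finset.sum_sub_distrib, ← Finset.sum_mul, hw1, one_mul]
  obtain ⟨D, hD, hDw⟩ : ∃ D, 0 < D ∧ (6 * L) ^ p = D :=
    ⟨_, Real.rpow_pos_of_pos (by positivity) p, rfl⟩
  rw [hDw]
  let r : Fin k → ℝ := fun j => ((G j \ I j).card : ℝ)
  let T : Fin k → ℝ := fun j => selfNormSq a (σ ^ 2) (I j) z
  have hT0 : ∀ j, 0 ≤ T j := fun j => selfNormSq_nonneg a (sq_nonneg σ) _ _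
  have hterm : ∀ j, |blockWeight p z G j * (blockMean z (G j) - a)| ≤
      36 * (D * σ / k * (√(2 * k) / √N)) * (√(r j) + √(T j)) := fun j => by
    obtain ⟨hn, hNn⟩ := hG.le_mul_card hk hkN j
    have hn0 : (0 : ℝ) < (G j).card := Nat.cast_pos.2 hn
    have hNn' : (N : ℝ) ≤ 2 * k * (G j).card := by exact_mod_cast hNn
    have h1 := abs_blockMean_sub_le hσ (hIG j) (hI j) (hcard j) (hV j) (hT j)
    have h2 : blockWeight p z G j * blockStd z (G j) ≤ D * σ / k :=
      hDw ▸ weight_mul_le hk hσ hL hp hd htest j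
    have h3 : (√((G j).card))⁻¹ ≤ √(2 * k) / √N := by
      rw [inv_eq_one_div, div_le_div_iff₀ (Real.sqrt_pos.2 hn0) (Real.sqrt_pos.2 hN0), one_mul,
        ← Real.sqrt_mul (by positivity)]
      exact Real.sqrt_le_sqrt hNn'
    have h4 : 0 ≤ √(r j) + √(T j) := by positivity
    rw [abs_mul, abs_of_nonneg (hw0 j)]
    calc _ ≤ blockWeight p z G j * (36 * blockStd z (G j) *
          ((√(r j) + √(T j)) / √((G j).card))) := mul_le_mul_of_nonneg_left h1 (hw0 j)
      _ = 36 * (blockWeight p z G j * blockStd z (G j) * (√((G j).card))⁻¹) *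
          (√(r j) + √(T j)) := by ring
      _ ≤ _ := by gcongr
  rw [herr]
  exact (Finset.abs_sum_le_sum_abs _ _).trans ((Finset.sum_le_sum fun j _ => hterm j).trans
    (sum_sqrt_add_sqrt_le hk hko hs hD.le hσ.le (fun j => Nat.cast_nonneg _) hT0 hout hTsum))

/-- The scale test is passed when half of the blocks have a standard deviation of at most `2 σ`. -/
theorem harmonic_mean_le {k : ℕ} (hk : 0 < k) {d : Fin k → ℝ} (hd : ∀ j, 0 < d j) {σ p : ℝ}
    (hσ : 0 < σ) (hp : 1 ≤ p) {A : Finset (Fin k)} (hA : (k : ℝ) / 2 ≤ A.card)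
    (hdA : ∀ j ∈ A, d j ≤ 2 * σ) :
    ((1 / (k : ℝ)) * ∑ j, 1 / d j ^ p)⁻¹ ≤ (4 * σ) ^ p := by
  have hk0 : (0 : ℝ) < k := Nat.cast_pos.2 hk
  have h2 : 0 < (2 * σ) ^ p := Real.rpow_pos_of_pos (by positivity) p
  have h4 : 2 * (2 * σ) ^ p ≤ (4 * σ) ^ p := by
    have e : (4 * σ) ^ p = 2 ^ p * (2 * σ) ^ p := by
      rw [← Real.mul_rpow (by norm_num) (by positivity)]
      congr 1
      ring
    rw [e]
    refine mul_le_mul_of_nonneg_right ?_ h2.le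
    calc (2 : ℝ) = 2 ^ (1 : ℝ) := (Real.rpow_one 2).symm
      _ ≤ 2 ^ p := Real.rpow_le_rpow_of_exponent_le (by norm_num) hp
  have h1 : A.card * (1 / (2 * σ) ^ p) ≤ ∑ j, 1 / d j ^ p := by
    rw [← nsmul_eq_mul, ← Finset.sum_const]
    calc _ ≤ ∑ j ∈ A, 1 / d j ^ p := by
          refine Finset.sum_le_sum fun j hj => ?_
          have := Real.rpow_pos_of_pos (hd j) p
          exact one_div_le_one_div_of_le this
            (Real.rpow_le_rpow (hd j).le (hdA j hj) (by linarith))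
      _ ≤ _ := Finset.sum_le_sum_of_subset_of_nonneg (Finset.subset_univ _) fun j _ _ => by
          have := Real.rpow_pos_of_pos (hd j) p
          positivity
  refine inv_le_of_inv_le₀ (Real.rpow_pos_of_pos (by positivity) p) ?_
  calc ((4 * σ) ^ p)⁻¹ ≤ (2 * (2 * σ) ^ p)⁻¹ := inv_anti₀ (by positivity) h4
    _ = 1 / k * (k / 2 * (1 / (2 * σ) ^ p)) := by field_simp
    _ ≤ 1 / k * (A.card * (1 / (2 * σ) ^ p)) := by gcongr
    _ ≤ _ := by gcongr

/-- If the scale test is passed with `2 ^ n` blocks, the selected number of blocks is some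
`2 ^ i ≤ 2 ^ n` for which the test is passed. -/
theorem exists_selectedBlocks_eq {N : ℕ} {C p τ : ℝ} {x : Fin N → ℝ}
    {G : (k : ℕ) → Fin k → Finset (Fin N)} {n : ℕ} (hn : 1 ≤ n) (hnN : n ≤ Nat.log 2 N)
    (h : ScaleTest C p τ x (G (2 ^ n))) :
    ∃ i, 1 ≤ i ∧ i ≤ n ∧ selectedBlocks C p τ x G = 2 ^ i ∧ ScaleTest C p τ x (G (2 ^ i)) := by
  have hmem : n ∈ {i : ℕ | 1 ≤ i ∧ i ≤ Nat.log 2 N ∧ ScaleTest C p τ x (G (2 ^ i))} :=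
    ⟨hn, hnN, h⟩
  have hs := Nat.sInf_mem ⟨n, hmem⟩
  refine ⟨sInf {i : ℕ | 1 ≤ i ∧ i ≤ Nat.log 2 N ∧ ScaleTest C p τ x (G (2 ^ i))}, hs.1,
    Nat.sInf_le hmem, ?_, hs.2.2⟩
  rw [selectedBlocks, selectedExponent, max_eq_left hs.1]

/-! ### Inliers in the merged sample -/

section Inliers

variable {m o : ℕ}

/-- The labels of the outliers in the merged sample. -/
def outlierLabels (m o : ℕ) : Finset (Fin (m + o)) := Finset.univ.filter fun i => m ≤ (i : ℕ)

/-- The positions of a block that hold inliers when the merged sample is listed in the order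
`ρ`. -/
def inlierPositions (ρ : Equiv.Perm (Fin (m + o))) (B : Finset (Fin (m + o))) :
    Finset (Fin (m + o)) :=
  B.filter fun i => ρ i ∉ outlierLabels m o

/-- The indices of the inliers that are placed in a block when the merged sample is listed in the
order `ρ`. -/
def inlierIndices (ρ : Equiv.Perm (Fin (m + o))) (B : Finset (Fin (m + o))) : Finset (Fin m) :=
  Finset.univ.filter fun a => ρ.symm (Fin.castAdd o a) ∈ B

theorem card_outlierLabels : (outlierLabels m o).card = o := by
  have : outlierLabels m o = Finset.univ.map (Fin.natAddEmb m : Fin o ↪ Fin (m + o)) := by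
    ext i
    simp only [outlierLabels, Finset.mem_filter, Finset.mem_univ, true_and, Finset.mem_map,
      Fin.natAddEmb_apply]
    refine ⟨fun h => ⟨⟨i - m, by omega⟩, Fin.ext (by simp; omega)⟩, ?_⟩
    rintro ⟨b, rfl⟩
    simp
  rw [this, Finset.card_map, Finset.card_univ, Fintype.card_fin]

theorem inlierPositions_subset (ρ : Equiv.Perm (Fin (m + o))) (B : Finset (Fin (m + o))) :
    inlierPositions ρ B ⊆ B := Finset.filter_subset _ _

theorem sdiff_inlierPositions (ρ : Equiv.Perm (Fin (m + o))) (B : Finset (Fin (m + o))) :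
    B \ inlierPositions ρ B = B.filter fun i => ρ i ∈ outlierLabels m o := by
  ext i
  simp only [inlierPositions, Finset.mem_sdiff, Finset.mem_filter]
  tauto

theorem sum_inlierPositions {M : Type*} [AddCommMonoid M] (ρ : Equiv.Perm (Fin (m + o)))
    (B : Finset (Fin (m + o))) (x : Fin m → ℝ) (y : Fin o → ℝ) (g : ℝ → M) :
    ∑ i ∈ inlierPositions ρ B, g (mergedSample x y ρ i) = ∑ a ∈ inlierIndices ρ B, g (x a) := by
  symm
  refine Finset.sum_bij (fun a _ => ρ.symm (Fin.castAdd o a)) (fun a ha => ?_)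
    (fun a _ b _ h => Fin.castAdd_injective m o (ρ.symm.injective h)) (fun i hi => ?_)
    (fun a _ => ?_)
  · simp only [inlierIndices, Finset.mem_filter, Finset.mem_univ, true_and] at ha
    simp [inlierPositions, outlierLabels, ha]
  · simp only [inlierPositions, outlierLabels, Finset.mem_filter, Finset.mem_univ, true_and,
      not_le] at hi
    have h : Fin.castAdd o ⟨ρ i, hi.2⟩ = ρ i := rfl
    refine ⟨⟨ρ i, hi.2⟩, ?_, ?_⟩
    · simp only [inlierIndices, Finset.mem_filter, Finset.mem_univ, true_and, h,
        Equiv.symm_apply_apply, hi.1]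
    · simp only [h, Equiv.symm_apply_apply]
  · simp [mergedSample]

theorem card_inlierPositions (ρ : Equiv.Perm (Fin (m + o))) (B : Finset (Fin (m + o))) :
    (inlierPositions ρ B).card = (inlierIndices ρ B).card := by
  have := sum_inlierPositions ρ B (fun _ => 0) (fun _ => 0) fun _ => 1
  simpa using this

theorem devSum_inlierPositions (ρ : Equiv.Perm (Fin (m + o))) (B : Finset (Fin (m + o)))
    (x : Fin m → ℝ) (y : Fin o → ℝ) (a : ℝ) :
    devSum a (inlierPositions ρ B) (mergedSample x y ρ) = devSum a (inlierIndices ρ B) x :=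
  sum_inlierPositions ρ B x y fun t => t - a

theorem devSq_inlierPositions (ρ : Equiv.Perm (Fin (m + o))) (B : Finset (Fin (m + o)))
    (x : Fin m → ℝ) (y : Fin o → ℝ) (a : ℝ) :
    devSq a (inlierPositions ρ B) (mergedSample x y ρ) = devSq a (inlierIndices ρ B) x :=
  sum_inlierPositions ρ B x y fun t => (t - a) ^ 2

theorem selfNormSq_inlierPositions (ρ : Equiv.Perm (Fin (m + o))) (B : Finset (Fin (m + o)))
    (x : Fin m → ℝ) (y : Fin o → ℝ) (a v : ℝ) :
    selfNormSq a v (inlierPositions ρ B) (mergedSample x y ρ) =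
      selfNormSq a v (inlierIndices ρ B) x := by
  unfold selfNormSq
  rw [devSum_inlierPositions, devSq_inlierPositions, card_inlierPositions]

theorem disjoint_inlierIndices (ρ : Equiv.Perm (Fin (m + o))) {B B' : Finset (Fin (m + o))}
    (h : Disjoint B B') : Disjoint (inlierIndices ρ B) (inlierIndices ρ B') := by
  rw [Finset.disjoint_left] at h ⊢
  intro a ha
  simp only [inlierIndices, Finset.mem_filter, Finset.mem_univ, true_and] at ha ⊢
  exact h ha

theorem sum_card_sdiff_inlierPositions_le {k : ℕ} {G : Fin k → Finset (Fin (m + o))}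
    (hG : ∀ i j, i ≠ j → Disjoint (G i) (G j)) (ρ : Equiv.Perm (Fin (m + o))) :
    ∑ j, (G j \ inlierPositions ρ (G j)).card ≤ o := by
  have hpw : ∀ i ∈ Finset.univ, ∀ j ∈ Finset.univ, i ≠ j →
      Disjoint (G i \ inlierPositions ρ (G i)) (G j \ inlierPositions ρ (G j)) := fun i _ j _ hij =>
    (hG i j hij).mono Finset.sdiff_subset Finset.sdiff_subset
  rw [← Finset.card_biUnion hpw]
  refine le_trans ?_ (Finset.card_map ρ.symm.toEmbedding |>.trans
    (card_outlierLabels (m := m) (o := o))).le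
  refine Finset.card_le_card fun i hi => ?_
  obtain ⟨j, _, hij⟩ := Finset.mem_biUnion.1 hi
  rw [sdiff_inlierPositions] at hij
  rw [Finset.mem_map_equiv, Equiv.symm_symm]
  exact (Finset.mem_filter.1 hij).2

end Inliers

section Regular

variable {m o : ℕ}

/-- The order `ρ` leaves at least a quarter of inliers in each block, for up to `2 ^ n` blocks. -/
def IsBalanced (G : (k : ℕ) → Fin k → Finset (Fin (m + o))) (n : ℕ)
    (ρ : Equiv.Perm (Fin (m + o))) : Prop :=
  ∀ i, 1 ≤ i → i ≤ n → ∀ j,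
    (G (2 ^ i) j).card ≤ 4 * (inlierPositions ρ (G (2 ^ i) j)).card

/-- The conditions on the inliers `x` that make the estimator accurate, given the order `ρ`: for up
to `2 ^ n` blocks, the second moments are not too small and the self-normalized sums not too large
in each block and on the average; for `2 ^ n` blocks, few second moments are too large. -/
def IsRegular (a σ s : ℝ) (G : (k : ℕ) → Fin k → Finset (Fin (m + o))) (n : ℕ)
    (ρ : Equiv.Perm (Fin (m + o))) (x : Fin m → ℝ) : Prop :=
  (∀ i, 1 ≤ i → i ≤ n →
    (∀ j, (inlierIndices ρ (G (2 ^ i) j)).card * σ ^ 2 / 2 <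
      devSq a (inlierIndices ρ (G (2 ^ i) j)) x) ∧
    (∀ j, selfNormSq a (σ ^ 2) (inlierIndices ρ (G (2 ^ i) j)) x <
      ((inlierIndices ρ (G (2 ^ i) j)).card : ℝ) / 5) ∧
    ∑ j, selfNormSq a (σ ^ 2) (inlierIndices ρ (G (2 ^ i) j)) x < 4 * (((2 ^ i : ℕ) : ℝ) + s)) ∧
  ∃ A : Finset (Fin (2 ^ n)), (A.card : ℝ) < 3 * ((2 ^ n : ℕ) : ℝ) / 8 ∧
    ∀ j, j ∉ A → devSq a (inlierIndices ρ (G (2 ^ n) j)) x <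
      4 * ((inlierIndices ρ (G (2 ^ n) j)).card * σ ^ 2)

/-- Whatever the outliers are, the adaptive estimator is accurate when the order is balanced, the
inliers are regular and the preliminary scale estimate is of the right order. -/
theorem adaptiveEstimator_accurate {C p τ a σ s : ℝ} (hC0 : 0 ≤ C) (hC1 : C < 1) (hp : 1 ≤ p)
    (hσ : 0 < σ) (hs : 0 ≤ s) {G : (k : ℕ) → Fin k → Finset (Fin (m + o))} {n : ℕ} (hn : 1 ≤ n)
    (hnN : n ≤ Nat.log 2 (m + o)) (hn8 : 8 * o ≤ 2 ^ n) (hn16 : 2 ^ n ≤ 16 * o) (ho : 0 < o)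
    (hG : ∀ i, 1 ≤ i → i ≤ Nat.log 2 (m + o) → IsBlockPartition (G (2 ^ i)))
    {ρ : Equiv.Perm (Fin (m + o))} (hρ : IsBalanced G n ρ) {x : Fin m → ℝ}
    (hx : IsRegular a σ s G n ρ x) (y : Fin o → ℝ) (hτ1 : 1 / 20 ≤ τ / σ) (hτ2 : τ / σ ≤ 4) :
    (∀ j, 0 < blockStd (mergedSample x y ρ) (G (selectedBlocks C p τ (mergedSample x y ρ) G) j)) ∧
    |adaptiveEstimator C p τ (mergedSample x y ρ) G - a| ≤
      700 * (6 * (320 / (1 - C))) ^ p * σ *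
        (√(s / ((m + o : ℕ) : ℝ)) + √((o : ℝ) / ((m + o : ℕ) : ℝ))) := by
  rw [le_div_iff₀ hσ] at hτ1
  rw [div_le_iff₀ hσ] at hτ2
  have hC : 0 < 1 - C := by linarith
  set z := mergedSample x y ρ
  have hpow : ∀ i, i ≤ n → 2 ^ i ≤ m + o := fun i hi =>
    (Nat.pow_le_pow_right (by norm_num) (hi.trans hnN)).trans
      (Nat.pow_log_le_self 2 (by omega))
  have hI : ∀ i, 1 ≤ i → i ≤ n → ∀ j, (inlierPositions ρ (G (2 ^ i) j)).Nonempty := by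
    intro i h1 hi j
    have h2 := ((hG i h1 (hi.trans hnN)).le_mul_card (by positivity) (hpow i hi) j).1
    have h3 := hρ i h1 hi j
    exact Finset.card_pos.1 (by omega)
  have hV : ∀ i, 1 ≤ i → i ≤ n → ∀ j, (inlierPositions ρ (G (2 ^ i) j)).card * σ ^ 2 / 2 ≤
      devSq a (inlierPositions ρ (G (2 ^ i) j)) z := fun i h1 hi j => by
    rw [devSq_inlierPositions, card_inlierPositions]
    exact ((hx.1 i h1 hi).1 j).le
  have hT : ∀ i, 1 ≤ i → i ≤ n → ∀ j, selfNormSq a (σ ^ 2) (inlierPositions ρ (G (2 ^ i) j)) z ≤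
      ((inlierPositions ρ (G (2 ^ i) j)).card : ℝ) / 5 := fun i h1 hi j => by
    rw [selfNormSq_inlierPositions, card_inlierPositions]
    exact ((hx.1 i h1 hi).2.1 j).le
  have hd0 : ∀ i, 1 ≤ i → i ≤ n → ∀ j, 0 < blockStd z (G (2 ^ i) j) := fun i h1 hi j =>
    lt_of_lt_of_le (by positivity) (div_six_le_blockStd hσ (inlierPositions_subset _ _)
      (hI i h1 hi j) (hρ i h1 hi j) (hV i h1 hi j) (hT i h1 hi j))
  have hout : ∀ i, 1 ≤ i → i ≤ n →
      ∑ j, (G (2 ^ i) j \ inlierPositions ρ (G (2 ^ i) j)).card ≤ o := fun i h1 hi =>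
    sum_card_sdiff_inlierPositions_le (hG i h1 (hi.trans hnN)).disjoint ρ
  -- With `2 ^ n` blocks the test is passed: few blocks contain outliers.
  have htest : ScaleTest C p τ z (G (2 ^ n)) := by
    classical
    obtain ⟨A, hA, hdA⟩ := hx.2
    let A' : Finset (Fin (2 ^ n)) :=
      Finset.univ.filter fun j => (G (2 ^ n) j \ inlierPositions ρ (G (2 ^ n) j)).Nonempty
    have hA' : A'.card ≤ o := by
      refine le_trans ?_ (hout n hn le_rfl)
      rw [Finset.card_eq_sum_ones]
      refine (Finset.sum_le_sum fun j hj => ?_).trans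
        (Finset.sum_le_sum_of_subset (Finset.subset_univ A'))
      exact Finset.card_pos.2 (Finset.mem_filter.1 hj).2
    have hcard : (((2 ^ n : ℕ) : ℝ)) / 2 ≤ ((A ∪ A')ᶜ.card : ℝ) := by
      have h1 := Finset.card_union_le A A'
      have h2 := Finset.card_add_card_compl (A ∪ A')
      rw [Fintype.card_fin] at h2
      have h3 : ((A ∪ A').card : ℝ) ≤ A.card + A'.card := by exact_mod_cast h1
      have h4 : ((A ∪ A').card : ℝ) + ((A ∪ A')ᶜ.card : ℝ) = ((2 ^ n : ℕ) : ℝ) := by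
        exact_mod_cast h2
      have h5 : 8 * (A'.card : ℝ) ≤ ((2 ^ n : ℕ) : ℝ) := by
        exact_mod_cast (Nat.mul_le_mul_left 8 hA').trans hn8
      linarith
    refine Or.inr ((harmonic_mean_le (by positivity) (hd0 n hn le_rfl) hσ hp hcard
      fun j hj => ?_).trans ?_)
    · rw [Finset.mem_compl, Finset.mem_union, not_or] at hj
      have h1 : G (2 ^ n) j = inlierPositions ρ (G (2 ^ n) j) := by
        refine (Finset.sdiff_eq_empty_iff_subset.1 ?_).antisymm (inlierPositions_subset _ _)
        rw [← Finset.not_nonempty_iff_eq_empty]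
        exact fun h => hj.2 (Finset.mem_filter.2 ⟨Finset.mem_univ _, h⟩)
      have hne := (hI n hn le_rfl j).mono (inlierPositions_subset _ _)
      have h2 := card_mul_blockStd_sq_le hne z a
      have h3 := hdA j hj.1
      rw [← devSq_inlierPositions ρ _ x y, ← card_inlierPositions, ← h1] at h3
      have h4 : (0 : ℝ) < (G (2 ^ n) j).card := Nat.cast_pos.2 hne.card_pos
      refine le_of_sq_le_sq ?_ (by positivity)
      refine le_of_mul_le_mul_left (h2.trans (h3.le.trans (le_of_eq ?_))) h4
      ring
    · refine Real.rpow_le_rpow (by positivity) ?_ (by linarith)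
      rw [le_div_iff₀ hC]
      nlinarith
  obtain ⟨i, h1, hi, hsel, hti⟩ := exists_selectedBlocks_eq hn hnN htest
  unfold adaptiveEstimator
  rw [hsel]
  refine ⟨hd0 i h1 hi, ?_⟩
  have hki : 2 ^ i ≤ 16 * o := (Nat.pow_le_pow_right (by norm_num) hi).trans hn16
  have hout' : ∑ j, ((G (2 ^ i) j \ inlierPositions ρ (G (2 ^ i) j)).card : ℝ) ≤ o := by
    exact_mod_cast hout i h1 hi
  refine abs_blockEstimator_sub_le (by positivity) (hpow i hi) hki (hG i h1 (hi.trans hnN)) hσ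
    (by positivity) hp hs (fun j => inlierPositions_subset ρ _) (hI i h1 hi) (hρ i h1 hi)
    (hV i h1 hi) (hT i h1 hi) hout' ?_ ?_
  · simp only [z, selfNormSq_inlierPositions]
    exact (hx.1 i h1 hi).2.2.le
  · rcases hti with ⟨j, hj⟩ | h
    · exact absurd hj (hd0 i h1 hi j).ne'
    · refine h.trans (Real.rpow_le_rpow ?_ ?_ (by linarith))
      · have : 0 < τ := by nlinarith
        positivity
      · rw [div_mul_eq_mul_div]
        exact div_le_div_of_nonneg_right (by linarith) hC.le

end Regular

/-! ### Probability of a balanced order and of regular inliers -/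

theorem sum_two_pow_le (n : ℕ) :
    ∑ i ∈ Finset.Icc 1 n, ((2 ^ i : ℕ) : ℝ) ≤ 2 * ((2 ^ n : ℕ) : ℝ) := by
  induction n with
  | zero => simp
  | succ n ih =>
    rw [Finset.sum_Icc_succ_top (by omega)]
    push_cast at ih ⊢
    rw [pow_succ]
    linarith

section Probability

variable {m o n : ℕ} {G : (k : ℕ) → Fin k → Finset (Fin (m + o))} {l : ℝ}

/-- A uniformly random order is balanced with high probability. -/
theorem card_not_isBalanced_le (ho : 4 * o ≤ m + o)
    (hl : ∀ i, 1 ≤ i → i ≤ n → ∀ j, l ≤ (G (2 ^ i) j).card) :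
    ({ρ | ¬IsBalanced G n ρ}.ncard : ℝ) ≤
      2 * ((2 ^ n : ℕ) : ℝ) * Real.exp (-(l / 4)) * Fintype.card (Equiv.Perm (Fin (m + o))) := by
  classical
  set M : ℝ := (Fintype.card (Equiv.Perm (Fin (m + o))) : ℝ)
  let U : Finset (Fin (m + o)) → Finset (Equiv.Perm (Fin (m + o))) := fun B =>
    Finset.univ.filter fun ρ =>
      3 * B.card < 4 * (B.filter fun i => ρ i ∈ outlierLabels m o).card
  have hU : ∀ B : Finset (Fin (m + o)), l ≤ B.card →
      ((U B).card : ℝ) ≤ Real.exp (-(l / 4)) * M := fun B hB => by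
    refine (card_perm_many_marked_le (O := outlierLabels m o) ?_ B).trans ?_
    · rw [card_outlierLabels, Fintype.card_fin]
      exact ho
    · gcongr
  have hsub : {ρ | ¬IsBalanced G n ρ} ⊆
      (((Finset.Icc 1 n).biUnion fun i => Finset.univ.biUnion fun j => U (G (2 ^ i) j) :
        Finset (Equiv.Perm (Fin (m + o)))) : Set (Equiv.Perm (Fin (m + o)))) := fun ρ hρ => by
    simp only [Set.mem_ofPred_eq, IsBalanced, not_forall] at hρ
    obtain ⟨i, h1, hi, j, hj⟩ := hρ
    refine Finset.mem_coe.2 (Finset.mem_biUnion.2 ⟨i, Finset.mem_Icc.2 ⟨h1, hi⟩,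
      Finset.mem_biUnion.2 ⟨j, Finset.mem_univ _, Finset.mem_filter.2 ⟨Finset.mem_univ _, ?_⟩⟩⟩)
    rw [← sdiff_inlierPositions]
    have := Finset.card_sdiff_add_card_eq_card (inlierPositions_subset ρ (G (2 ^ i) j))
    omega
  calc ({ρ | ¬IsBalanced G n ρ}.ncard : ℝ)
      ≤ (((Finset.Icc 1 n).biUnion fun i => Finset.univ.biUnion fun j => U (G (2 ^ i) j)).card
          : ℝ) := by
        rw [← Set.ncard_coe_finset]
        exact_mod_cast Set.ncard_le_ncard hsub (Finset.finite_toSet _)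
    _ ≤ ∑ i ∈ Finset.Icc 1 n, ∑ j, ((U (G (2 ^ i) j)).card : ℝ) := by
        exact_mod_cast Finset.card_biUnion_le.trans
          (Finset.sum_le_sum fun i _ => Finset.card_biUnion_le)
    _ ≤ ∑ i ∈ Finset.Icc 1 n, ((2 ^ i : ℕ) : ℝ) * (Real.exp (-(l / 4)) * M) := by
        refine Finset.sum_le_sum fun i hi => ?_
        rw [Finset.mem_Icc] at hi
        have := Finset.sum_le_card_nsmul Finset.univ (fun j => ((U (G (2 ^ i) j)).card : ℝ)) _
          fun j _ => hU _ (hl i hi.1 hi.2 j)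
        rwa [Finset.card_univ, Fintype.card_fin, nsmul_eq_mul] at this
    _ ≤ _ := by
        rw [← Finset.sum_mul, mul_assoc]
        gcongr
        exact sum_two_pow_le n

/-- Given a balanced order, the inliers are regular with high probability. -/
theorem measureReal_not_isRegular_le {P : Measure ℝ} [IsProbabilityMeasure P] (hP : MemLp id 2 P)
    (hσ : 0 < stdDev P) {r : ℝ} (hr0 : 0 < r)
    (hr : ∀ (m : ℕ) (J : Finset (Fin m)), (Measure.pi fun _ : Fin m => P).real
        {x | devSq (mean P) J x ≤ J.card * stdDev P ^ 2 / 2} ≤ Real.exp (-(r * J.card)))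
    (hl0 : 0 < l) (hl : ∀ i, 1 ≤ i → i ≤ n → ∀ j, l ≤ (G (2 ^ i) j).card) (hn : 1 ≤ n)
    (hn8 : 8 * o ≤ 2 ^ n)
    (hG : ∀ i, 1 ≤ i → i ≤ n → ∀ j j', j ≠ j' → Disjoint (G (2 ^ i) j) (G (2 ^ i) j'))
    {ρ : Equiv.Perm (Fin (m + o))} (hρ : IsBalanced G n ρ) (s : ℝ) :
    (Measure.pi fun _ : Fin m => P).real {x | ¬IsRegular (mean P) (stdDev P) s G n ρ x} ≤
      2 * ((2 ^ n : ℕ) : ℝ) * (Real.exp (-(r * (l / 4))) + Real.exp (-(l / 80)) * (5 / 4)) +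
        n * Real.exp (-s) + Real.exp (-((o : ℝ) / 4)) := by
  classical
  set Q := Measure.pi fun _ : Fin m => P
  let J : (i : ℕ) → Fin (2 ^ i) → Finset (Fin m) := fun i j => inlierIndices ρ (G (2 ^ i) j)
  let D : (i : ℕ) → Fin (2 ^ i) → Set (Fin m → ℝ) := fun i j =>
    {x | devSq (mean P) (J i j) x ≤ (J i j).card * stdDev P ^ 2 / 2}
  let E : (i : ℕ) → Fin (2 ^ i) → Set (Fin m → ℝ) := fun i j =>
    {x | ((J i j).card : ℝ) / 5 ≤ selfNormSq (mean P) (stdDev P ^ 2) (J i j) x}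
  let F : ℕ → Set (Fin m → ℝ) := fun i =>
    {x | 4 * (((2 ^ i : ℕ) : ℝ) + s) ≤ ∑ j, selfNormSq (mean P) (stdDev P ^ 2) (J i j) x}
  let H : Set (Fin m → ℝ) := {x | 3 * ((2 ^ n : ℕ) : ℝ) / 8 ≤ ((Finset.univ.filter fun j =>
          4 * ((J n j).card * stdDev P ^ 2) ≤ devSq (mean P) (J n j) x).card : ℝ)}
  have hsub : {x | ¬IsRegular (mean P) (stdDev P) s G n ρ x} ⊆
      (⋃ i ∈ Finset.Icc 1 n, ((⋃ j ∈ Finset.univ, (D i j ∪ E i j)) ∪ F i)) ∪ H := by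
    intro x hx
    by_contra hcon
    simp only [Set.mem_union, Set.mem_iUnion, not_or, not_exists, Finset.mem_univ,
      Finset.mem_Icc] at hcon
    obtain ⟨h1, h2⟩ := hcon
    refine hx ⟨fun i hi1 hin => ⟨fun j => ?_, fun j => ?_, ?_⟩, ?_⟩
    · exact not_le.1 ((h1 i ⟨hi1, hin⟩).1 j trivial).1
    · exact not_le.1 ((h1 i ⟨hi1, hin⟩).1 j trivial).2
    · exact not_le.1 (h1 i ⟨hi1, hin⟩).2
    · refine ⟨Finset.univ.filter fun j =>
          4 * ((J n j).card * stdDev P ^ 2) ≤ devSq (mean P) (J n j) x, not_le.1 h2,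
        fun j hj => ?_⟩
      exact not_le.1 fun h => hj (Finset.mem_filter.2 ⟨Finset.mem_univ _, h⟩)
  have hq : ∀ i, 1 ≤ i → i ≤ n → ∀ j, l / 4 ≤ (J i j).card := fun i h1 hi j => by
    have h2 := hl i h1 hi j
    have h3 : ((G (2 ^ i) j).card : ℝ) ≤ 4 * (J i j).card := by
      have := hρ i h1 hi j
      rw [card_inlierPositions] at this
      exact_mod_cast this
    linarith
  have hne : ∀ i, 1 ≤ i → i ≤ n → ∀ j, (J i j).Nonempty := fun i h1 hi j => by
    have : (0 : ℝ) < (J i j).card := lt_of_lt_of_le (by positivity) (hq i h1 hi j)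
    exact Finset.card_pos.1 (Nat.cast_pos.1 this)
  have hdisj : ∀ i, 1 ≤ i → i ≤ n → ∀ j j', j ≠ j' → Disjoint (J i j) (J i j') :=
    fun i h1 hi j j' h => disjoint_inlierIndices ρ (hG i h1 hi j j' h)
  have hDE : ∀ i, 1 ≤ i → i ≤ n → ∀ j, Q.real (D i j ∪ E i j) ≤
      Real.exp (-(r * (l / 4))) + Real.exp (-(l / 80)) * (5 / 4) := fun i h1 hi j => by
    have h2 := hq i h1 hi j
    refine (measureReal_union_le _ _).trans (add_le_add ((hr m (J i j)).trans ?_)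
      ((measureReal_selfNormSq_ge_le hP hσ (hne i h1 hi j)).trans ?_))
    · gcongr
    · refine mul_le_mul_of_nonneg_right (Real.exp_le_exp.2 ?_) (by norm_num)
      linarith
  have hi : ∀ i ∈ Finset.Icc 1 n, Q.real ((⋃ j ∈ Finset.univ, (D i j ∪ E i j)) ∪ F i) ≤
      ((2 ^ i : ℕ) : ℝ) * (Real.exp (-(r * (l / 4))) + Real.exp (-(l / 80)) * (5 / 4)) +
        Real.exp (-s) := fun i hi => by
    rw [Finset.mem_Icc] at hi
    refine (measureReal_union_le _ _).trans (add_le_add ?_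
      (measureReal_sum_selfNormSq_ge_le hP hσ (hdisj i hi.1 hi.2) (hne i hi.1 hi.2) s))
    refine (measureReal_biUnion_finset_le _ _).trans ?_
    have := Finset.sum_le_card_nsmul Finset.univ (fun j => Q.real (D i j ∪ E i j)) _
      fun j _ => hDE i hi.1 hi.2 j
    rwa [Finset.card_univ, Fintype.card_fin, nsmul_eq_mul] at this
  refine (measureReal_mono hsub).trans ((measureReal_union_le _ _).trans (add_le_add ?_
    (measureReal_card_devSq_ge_le hP hσ hn8 (hdisj n hn le_rfl) (hne n hn le_rfl))))
  refine (measureReal_biUnion_finset_le _ _).trans ((Finset.sum_le_sum hi).trans ?_)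
  rw [Finset.sum_add_distrib, ← Finset.sum_mul, Finset.sum_const, Nat.card_Icc, nsmul_eq_mul,
    Nat.add_sub_cancel]
  gcongr
  exact sum_two_pow_le n

/-- An event that is unlikely for each value of an independent discrete variable is unlikely. -/
theorem measureReal_le_of_indepFun {Ω α β : Type*} [MeasurableSpace Ω] {Pr : Measure Ω}
    [IsProbabilityMeasure Pr] [MeasurableSpace α] [Fintype β] [MeasurableSpace β]
    [MeasurableSingletonClass β] {X : Ω → α} {π : Ω → β} (hX : Measurable X) (hπ : Measurable π)
    (h : IndepFun X π Pr) (R : β → Prop) (bad : β → Set α) {b : ℝ} (hb : 0 ≤ b)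
    (hbad : ∀ ρ, R ρ → (Pr.map X).real (bad ρ) ≤ b) :
    Pr.real {ω | R (π ω) ∧ X ω ∈ bad (π ω)} ≤ b := by
  classical
  have : IsProbabilityMeasure (Pr.map X) := Measure.isProbabilityMeasure_map hX.aemeasurable
  have : IsProbabilityMeasure (Pr.map π) := Measure.isProbabilityMeasure_map hπ.aemeasurable
  let S : Finset β := Finset.univ.filter R
  -- The sets `bad ρ` need not be measurable.
  let T : β → Set α := fun ρ => toMeasurable (Pr.map X) (bad ρ)
  have hsub : {ω | R (π ω) ∧ X ω ∈ bad (π ω)} ⊆ ⋃ ρ ∈ S, (X ⁻¹' T ρ ∩ π ⁻¹' {ρ}) := fun ω hω =>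
    Set.mem_iUnion₂.2 ⟨π ω, Finset.mem_filter.2 ⟨Finset.mem_univ _, hω.1⟩,
      subset_toMeasurable _ _ hω.2, rfl⟩
  have hterm : ∀ ρ ∈ S, Pr.real (X ⁻¹' T ρ ∩ π ⁻¹' {ρ}) ≤ b * (Pr.map π).real {ρ} := by
    intro ρ hρ
    have hT : MeasurableSet (T ρ) := measurableSet_toMeasurable _ _
    have h1 := hbad ρ (Finset.mem_filter.1 hρ).2
    rw [measureReal_def, h.measure_inter_preimage_eq_mul _ _ hT (measurableSet_singleton ρ),
      ENNReal.toReal_mul, ← Measure.map_apply hX hT,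
      ← Measure.map_apply hπ (measurableSet_singleton ρ), measure_toMeasurable]
    exact mul_le_mul_of_nonneg_right h1 measureReal_nonneg
  refine (measureReal_mono hsub (measure_ne_top _ _)).trans
    ((measureReal_biUnion_finset_le _ _).trans ((Finset.sum_le_sum hterm).trans ?_))
  rw [← Finset.mul_sum]
  have h2 : ∑ ρ ∈ S, (Pr.map π).real {ρ} ≤ 1 := by
    rw [sum_measureReal_singleton]
    exact measureReal_le_one
  nlinarith

end Probability

/-! ### The failure probability of the adaptive estimator -/

theorem uniformOn_univ_real {α : Type*} [Fintype α] [MeasurableSpace α] [DiscreteMeasurableSpace α]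
    (s : Set α) : (uniformOn (Set.univ : Set α)).real s = s.ncard / Fintype.card α := by
  rw [measureReal_def, uniformOn_univ, ENNReal.toReal_div, Measure.count_apply (.of_discrete),
    ← Set.Finite.cast_ncard_eq (Set.toFinite s), ENat.toENNReal_coe, ENNReal.toReal_natCast,
    ENNReal.toReal_natCast]

instance discreteMeasurableSpace_perm (n : ℕ) :
    DiscreteMeasurableSpace (Equiv.Perm (Fin n)) := ⟨fun _ => trivial⟩

/-- The failure probability of the adaptive estimator, for at least one outlier and blocks of size
at least `l`. -/
theorem measureReal_accurate_ge {P : Measure ℝ} [IsProbabilityMeasure P] (hP : MemLp id 2 P)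
    (hσ : 0 < stdDev P) {r : ℝ} (hr0 : 0 < r)
    (hr : ∀ (m : ℕ) (J : Finset (Fin m)), (Measure.pi fun _ : Fin m => P).real
        {x | devSq (mean P) J x ≤ J.card * stdDev P ^ 2 / 2} ≤ Real.exp (-(r * J.card)))
    {C p : ℝ} (hC0 : 0 ≤ C) (hC1 : C < 1) (hp : 1 ≤ p) {m o n : ℕ} (ho : 0 < o)
    (hn : 1 ≤ n) (hnN : n ≤ Nat.log 2 (m + o)) (hn8 : 8 * o ≤ 2 ^ n) (hn16 : 2 ^ n ≤ 16 * o)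
    (hoN : 4 * o ≤ m + o) {G : (k : ℕ) → Fin k → Finset (Fin (m + o))}
    (hG : ∀ i, 1 ≤ i → i ≤ Nat.log 2 (m + o) → IsBlockPartition (G (2 ^ i)))
    {l : ℝ} (hl0 : 0 < l) (hl : ∀ i, 1 ≤ i → i ≤ n → ∀ j, l ≤ (G (2 ^ i) j).card)
    {Ω : Type*} [MeasurableSpace Ω] (Pr : Measure Ω) [IsProbabilityMeasure Pr]
    {X : Fin m → Ω → ℝ} {Y : Fin o → Ω → ℝ} {π : Ω → Equiv.Perm (Fin (m + o))}
    (hX : IsContaminatedSample Pr P X Y π) {τ : Ω → ℝ} (hτ : Measurable τ) {η : ℝ}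
    (hη : 1 - η ≤ Pr.real {ω | 1 / 20 ≤ τ ω / stdDev P ∧ τ ω / stdDev P ≤ 4})
    {s : ℝ} (hs : 0 ≤ s) :
    1 - (η + 2 * ((2 ^ n : ℕ) : ℝ) * Real.exp (-(l / 4)) +
      (2 * ((2 ^ n : ℕ) : ℝ) * (Real.exp (-(r * (l / 4))) + Real.exp (-(l / 80)) * (5 / 4)) +
        n * Real.exp (-s) + Real.exp (-((o : ℝ) / 4)))) ≤
      Pr.real {ω |
        let x := mergedSample (fun i => X i ω) (fun i => Y i ω) (π ω)
        (∀ j, 0 < blockStd x (G (selectedBlocks C p (τ ω) x G) j)) ∧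
        |adaptiveEstimator C p (τ ω) x G - mean P| ≤
          700 * (6 * (320 / (1 - C))) ^ p * stdDev P *
            (√(s / ((m + o : ℕ) : ℝ)) + √((o : ℝ) / ((m + o : ℕ) : ℝ)))} := by
  set S : Set Ω := {ω |
        let x := mergedSample (fun i => X i ω) (fun i => Y i ω) (π ω)
        (∀ j, 0 < blockStd x (G (selectedBlocks C p (τ ω) x G) j)) ∧
        |adaptiveEstimator C p (τ ω) x G - mean P| ≤
          700 * (6 * (320 / (1 - C))) ^ p * stdDev P *
            (√(s / ((m + o : ℕ) : ℝ)) + √((o : ℝ) / ((m + o : ℕ) : ℝ)))} with hS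
  let A : Set Ω := {ω | 1 / 20 ≤ τ ω / stdDev P ∧ τ ω / stdDev P ≤ 4}
  let B : Set Ω := {ω | ¬IsBalanced G n (π ω)}
  let D : Set Ω := {ω | IsBalanced G n (π ω) ∧
    (fun i => X i ω) ∈ {x | ¬IsRegular (mean P) (stdDev P) s G n (π ω) x}}
  have hcover : Set.univ ⊆ S ∪ (Aᶜ ∪ B ∪ D) := by
    intro ω _
    by_contra h
    simp only [Set.mem_union, not_or, Set.mem_compl_iff, not_not] at h
    obtain ⟨hSω, ⟨hA, hB⟩, hD⟩ := h
    have hB' : IsBalanced G n (π ω) := by_contra hB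
    have hD' : IsRegular (mean P) (stdDev P) s G n (π ω) fun i => X i ω :=
      by_contra fun h => hD ⟨hB', h⟩
    exact hSω (adaptiveEstimator_accurate hC0 hC1 hp hσ hs hn hnN hn8 hn16 ho hG hB' hD' _
      hA.1 hA.2)
  have hA : Pr.real Aᶜ ≤ η := by
    have hAm : MeasurableSet A :=
      (measurableSet_le measurable_const (hτ.div_const _)).inter
        (measurableSet_le (hτ.div_const _) measurable_const)
    rw [probReal_compl_eq_one_sub hAm]
    linarith
  have hB : Pr.real B ≤ 2 * ((2 ^ n : ℕ) : ℝ) * Real.exp (-(l / 4)) := by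
    have h1 : Pr.real B = (Pr.map π).real {ρ | ¬IsBalanced G n ρ} := by
      rw [map_measureReal_apply hX.measurable_order .of_discrete]
      rfl
    rw [h1, hX.law_order, uniformOn_univ_real,
      div_le_iff₀ (Nat.cast_pos.2 Fintype.card_pos)]
    exact card_not_isBalanced_le hoN hl
  have hD : Pr.real D ≤ 2 * ((2 ^ n : ℕ) : ℝ) *
      (Real.exp (-(r * (l / 4))) + Real.exp (-(l / 80)) * (5 / 4)) +
        n * Real.exp (-s) + Real.exp (-((o : ℝ) / 4)) := by
    have hlaw : Pr.map (fun ω i => X i ω) = Measure.pi fun _ : Fin m => P := by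
      rw [(iIndepFun_iff_map_fun_eq_pi_map
        fun i => (hX.measurable_inlier i).aemeasurable).1 hX.indep_inlier]
      simp only [hX.law_inlier]
    refine measureReal_le_of_indepFun (measurable_pi_lambda _ hX.measurable_inlier)
      hX.measurable_order (hX.indep.comp measurable_id measurable_snd) (IsBalanced G n)
      (fun ρ => {x | ¬IsRegular (mean P) (stdDev P) s G n ρ x}) (by positivity) fun ρ hρ => ?_
    rw [hlaw]
    exact measureReal_not_isRegular_le hP hσ hr0 hr hl0 hl hn hn8
      (fun i h1 hi => (hG i h1 (hi.trans hnN)).disjoint) hρ s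
  have h1 := measureReal_mono (μ := Pr) hcover
  rw [probReal_univ] at h1
  have h2 := measureReal_union_le (μ := Pr) S (Aᶜ ∪ B ∪ D)
  have h3 := measureReal_union_le (μ := Pr) (Aᶜ ∪ B) D
  have h4 := measureReal_union_le (μ := Pr) Aᶜ B
  linarith

/-- The error probability, with a rate `c` that depends on the distribution of the inliers only.
When `N / o` is smaller than a constant depending on this distribution, the claimed bound is
trivial, since then `o * exp (-(c * N / o)) ≥ 1`. -/
theorem exists_rate {C : ℝ} (hC0 : 0 ≤ C) (hC1 : C < 1) (P : Measure ℝ) :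
    ∃ c : ℝ, 0 < c ∧ ∀ [IsProbabilityMeasure P], MemLp id 2 P → 0 < stdDev P →
      ∀ (p : ℝ), 1 ≤ p → ∀ (m o : ℕ), 2 ≤ o → (o : ℝ) ≤ ((m + o : ℕ) : ℝ) / 4 →
      ∀ (G : (k : ℕ) → Fin k → Finset (Fin (m + o))),
        (∀ i, 1 ≤ i → i ≤ Nat.log 2 (m + o) → IsBlockPartition (G (2 ^ i))) →
      ∀ (Ω : Type*) [MeasurableSpace Ω] (Pr : Measure Ω) [IsProbabilityMeasure Pr]
        (X : Fin m → Ω → ℝ) (Y : Fin o → Ω → ℝ) (π : Ω → Equiv.Perm (Fin (m + o))),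
        IsContaminatedSample Pr P X Y π →
      ∀ (τ : Ω → ℝ), Measurable τ →
      ∀ (η : ℝ), 1 - η ≤ Pr.real {ω | 1 / 20 ≤ τ ω / stdDev P ∧ τ ω / stdDev P ≤ 4} →
      ∀ (s : ℝ), 0 < s →
        1 - 2 * Real.logb 2 (3 * (o : ℝ)) * Real.exp (-s)
            - (o : ℝ) * Real.exp (-(c * ((m + o : ℕ) : ℝ) / (o : ℝ)))
            - Real.exp (-(c * (o : ℝ))) - η
          ≤ Pr.real {ω |
              let x := mergedSample (fun i => X i ω) (fun i => Y i ω) (π ω)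
              (∀ j, 0 < blockStd x (G (selectedBlocks C p (τ ω) x G) j)) ∧
              |adaptiveEstimator C p (τ ω) x G - mean P| ≤
                700 * (6 * (320 / (1 - C))) ^ p * stdDev P *
                  (√(s / ((m + o : ℕ) : ℝ)) + √((o : ℝ) / ((m + o : ℕ) : ℝ)))} := by
  by_cases hcase : IsProbabilityMeasure P ∧ MemLp id 2 P ∧ 0 < stdDev P
  swap
  · exact ⟨1, one_pos, fun hP hσ => absurd ⟨inferInstance, hP, hσ⟩ hcase⟩
  obtain ⟨_, hP, hσ⟩ := hcase
  obtain ⟨r, hr0, hr⟩ := exists_measureReal_devSq_le hP hσ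
  obtain ⟨b, hb0, hb1, hb2⟩ : ∃ b : ℝ, 0 < b ∧ b ≤ r / 4 ∧ b ≤ 1 / 80 :=
    ⟨min (r / 4) (1 / 80), by positivity, min_le_left _ _, min_le_right _ _⟩
  -- `448 = 64 * 7`, and `2 ^ 7 = 128` is the constant in front of the exponential terms.
  refine ⟨b / 448, by positivity, ?_⟩
  intro _ _ _ p hp m o ho hoN G hG Ω _ Pr _ X Y π hX τ hτ η hη s hs
  obtain ⟨N, hN⟩ : ∃ N : ℝ, N = ((m + o : ℕ) : ℝ) := ⟨_, rfl⟩
  have ho0 : (0 : ℝ) < o := by positivity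
  have ho2 : (2 : ℝ) ≤ o := by exact_mod_cast ho
  have hη0 : 0 ≤ η := by
    have := hη.trans measureReal_le_one
    linarith
  have hlog : (0 : ℝ) ≤ 2 * Real.logb 2 (3 * (o : ℝ)) :=
    mul_nonneg (by norm_num) (Real.logb_nonneg (by norm_num) (by linarith))
  rcases lt_or_ge (b * N / (64 * o)) (7 * Real.log 2) with hsmall | hbig
  · refine le_trans ?_ measureReal_nonneg
    have h1 : Real.exp (-Real.log 2) ≤ Real.exp (-(b / 448 * N / o)) := by
      refine Real.exp_le_exp.2 (neg_le_neg ?_)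
      have : b / 448 * N / o = b * N / (64 * o) / 7 := by
        field_simp
        ring
      rw [this]
      linarith
    rw [Real.exp_neg, Real.exp_log two_pos] at h1
    rw [← hN]
    have h2 : 0 ≤ 2 * Real.logb 2 (3 * (o : ℝ)) * Real.exp (-s) := by positivity
    have h3 := Real.exp_pos (-(b / 448 * (o : ℝ)))
    have h4 : (2 : ℝ) * 2⁻¹ ≤ o * Real.exp (-(b / 448 * N / o)) := by gcongr
    norm_num at h4
    linarith
  have hl2 := Real.log_two_gt_d9
  have hN64 : 64 * (o : ℝ) ≤ N := by
    have hN0 : 0 ≤ N := hN ▸ Nat.cast_nonneg _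
    have h1 : 1 ≤ b * N / (64 * o) := by linarith
    rw [le_div_iff₀ (by positivity), one_mul] at h1
    nlinarith
  have hN64' : 64 * o ≤ m + o := by
    rw [hN] at hN64
    exact_mod_cast hN64
  let n := Nat.clog 2 (8 * o)
  have hn8 : 8 * o ≤ 2 ^ n := Nat.le_pow_clog (by norm_num) _
  have hn : 1 ≤ n := Nat.clog_pos (by norm_num) (by omega)
  have hn16 : 2 ^ n ≤ 16 * o := by
    have h1 : 2 ^ (n - 1) < 8 * o := Nat.pow_pred_clog_lt_self (by norm_num) (by omega)
    have h2 : 2 ^ n = 2 * 2 ^ (n - 1) := by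
      rw [← pow_succ']
      congr 1
      omega
    omega
  have hnN : n ≤ Nat.log 2 (m + o) := Nat.le_log_of_pow_le (by norm_num) (by omega)
  have hn16' : ((2 ^ n : ℕ) : ℝ) ≤ 16 * o := by exact_mod_cast hn16
  have hl : ∀ i, 1 ≤ i → i ≤ n → ∀ j, N / (32 * o) ≤ (G (2 ^ i) j).card := fun i h1 hi j => by
    have h2 : 2 ^ i ≤ 2 ^ n := Nat.pow_le_pow_right (by norm_num) hi
    have h3 := ((hG i h1 (hi.trans hnN)).le_mul_card (by positivity) (by omega) j).2
    rw [div_le_iff₀ (by positivity), hN]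
    have h4 : m + o ≤ (G (2 ^ i) j).card * (32 * o) := by
      refine h3.trans ?_
      rw [mul_comm]
      exact Nat.mul_le_mul_left _ (by omega)
    exact_mod_cast h4
  have hl0 : 0 < N / (32 * o) := div_pos (by linarith) (by positivity)
  refine le_trans ?_ (measureReal_accurate_ge hP hσ hr0 hr hC0 hC1 hp (by omega) hn hnN hn8 hn16
    (by omega) hG hl0 hl Pr hX hτ hη hs.le)
  rw [← hN]
  obtain ⟨l, hldef⟩ : ∃ l, l = N / (32 * o) := ⟨_, rfl⟩
  rw [← hldef] at hl0 ⊢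
  have hbl : b * N / (64 * o) = b * l / 2 := by
    rw [hldef]
    field_simp
    ring
  have hcl : b / 448 * N / o = b * l / 14 := by
    rw [hldef]
    field_simp
    ring
  have e1 : Real.exp (-(l / 4)) ≤ Real.exp (-(b * l)) := Real.exp_le_exp.2 (by nlinarith)
  have e2 : Real.exp (-(r * (l / 4))) ≤ Real.exp (-(b * l)) := Real.exp_le_exp.2 (by nlinarith)
  have e3 : Real.exp (-(l / 80)) ≤ Real.exp (-(b * l)) := Real.exp_le_exp.2 (by nlinarith)
  have e4 : Real.exp (-((o : ℝ) / 4)) ≤ Real.exp (-(b / 448 * (o : ℝ))) :=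
    Real.exp_le_exp.2 (by nlinarith)
  have e5 : 128 * Real.exp (-(b * l)) ≤ Real.exp (-(b / 448 * N / o)) := by
    have h1 : (128 : ℝ) = Real.exp (7 * Real.log 2) := by
      rw [mul_comm, Real.exp_mul, Real.exp_log two_pos]
      norm_num
    rw [h1, ← Real.exp_add, Real.exp_le_exp, hcl]
    rw [hbl] at hbig
    nlinarith
  have e6 : (n : ℝ) ≤ 2 * Real.logb 2 (3 * (o : ℝ)) := by
    have h1 : (n : ℝ) ≤ Real.logb 2 ((3 * (o : ℝ)) ^ 2) := by
      rw [Real.le_logb_iff_rpow_le (by norm_num) (by positivity), Real.rpow_natCast]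
      push_cast at hn16'
      nlinarith
    rw [Real.logb_pow] at h1
    exact_mod_cast h1
  have e7 : n * Real.exp (-s) ≤ 2 * Real.logb 2 (3 * (o : ℝ)) * Real.exp (-s) := by gcongr
  have e8 : 2 * ((2 ^ n : ℕ) : ℝ) * Real.exp (-(l / 4)) + 2 * ((2 ^ n : ℕ) : ℝ) *
      (Real.exp (-(r * (l / 4))) + Real.exp (-(l / 80)) * (5 / 4)) ≤
      o * Real.exp (-(b / 448 * N / o)) := by
    have h0 := Real.exp_pos (-(b * l))
    calc _ = 2 * ((2 ^ n : ℕ) : ℝ) * (Real.exp (-(l / 4)) +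
          (Real.exp (-(r * (l / 4))) + Real.exp (-(l / 80)) * (5 / 4))) := by ring
      _ ≤ 2 * (16 * o) * (4 * Real.exp (-(b * l))) := by
          refine mul_le_mul (by linarith) (by linarith) (by positivity) (by positivity)
      _ = o * (128 * Real.exp (-(b * l))) := by ring
      _ ≤ _ := by gcongr
  linarith

end RobustMean

theorem theorem4 (C : ℝ) (hC0 : 0 ≤ C) (hC1 : C < 1) :
    ∃ (c : Measure ℝ → ℝ) (K : ℝ → ℝ), (∀ P, 0 < c P) ∧ (∀ p, 0 < K p) ∧
      ∀ (P : Measure ℝ) [IsProbabilityMeasure P], MemLp id 2 P → 0 < RobustMean.stdDev P →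
      ∀ (p : ℝ), 1 ≤ p →
      ∀ (m o : ℕ), 2 ≤ o → (o : ℝ) ≤ ((m + o : ℕ) : ℝ) / 4 →
      ∀ (G : (k : ℕ) → Fin k → Finset (Fin (m + o))),
        (∀ i, 1 ≤ i → i ≤ Nat.log 2 (m + o) → RobustMean.IsBlockPartition (G (2 ^ i))) →
      ∀ (Ω : Type*) [MeasurableSpace Ω] (Pr : Measure Ω) [IsProbabilityMeasure Pr]
        (X : Fin m → Ω → ℝ) (Y : Fin o → Ω → ℝ) (π : Ω → Equiv.Perm (Fin (m + o))),
        RobustMean.IsContaminatedSample Pr P X Y π →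
      ∀ (τ : Ω → ℝ), Measurable τ →
      ∀ (η : ℝ), 1 - η ≤ Pr.real {ω | 1 / 20 ≤ τ ω / RobustMean.stdDev P ∧
          τ ω / RobustMean.stdDev P ≤ 4} →
      ∀ (s : ℝ), 0 < s →
        1 - 2 * Real.logb 2 (3 * (o : ℝ)) * Real.exp (-s)
            - (o : ℝ) * Real.exp (-(c P * ((m + o : ℕ) : ℝ) / (o : ℝ)))
            - Real.exp (-(c P * (o : ℝ))) - η
          ≤ Pr.real {ω |
              let x := RobustMean.mergedSample (fun i => X i ω) (fun i => Y i ω) (π ω)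
              (∀ j, 0 < RobustMean.blockStd x
                (G (RobustMean.selectedBlocks C p (τ ω) x G) j)) ∧
              |RobustMean.adaptiveEstimator C p (τ ω) x G - RobustMean.mean P| ≤
                K p * RobustMean.stdDev P *
                  (√(s / ((m + o : ℕ) : ℝ)) + √((o : ℝ) / ((m + o : ℕ) : ℝ)))} := by
  choose c hc h using RobustMean.exists_rate hC0 hC1
  have hL : 0 < 6 * (320 / (1 - C)) := mul_pos (by norm_num) (div_pos (by norm_num) (by linarith))
  refine ⟨c, fun p => 700 * (6 * (320 / (1 - C))) ^ p, hc,
    fun p => mul_pos (by norm_num) (Real.rpow_pos_of_pos hL p), ?_⟩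
  intro P _ hP hσ
  exact h P hP hσ
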